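/- Let $\Omega\subset\mathbb R^2$ be a bounded, open, connected set with Lipschitz boundary, and let $\Gamma_0,\Gamma_1$ be disjoint sets with $\partial\Omega=\overline{\Gamma_0\cup\Gamma_1}$, where $\partial\Omega\setminus(\Gamma_0\cup\Gamma_1)$ has zero length (one-dimensional Hausdorff measure) and $\Gamma_0$ has positive length. Let $\nu$ be the unit outward normal on $\partial\Omega$, let $H^1_{\Gamma_0}(\Omega)$ be the space of all $v\in H^1(\Omega)$ whose trace vanishes on $\Gamma_0$, and put $$D(\mathcal A)=\Big\{w\in H^2(\Omega)\cap H^1_{\Gamma_0}(\Omega):\ \frac{\partial w}{\partial\nu}=0\text{ on }\Gamma_1\Big\},\qquad \mathcal A w=\Delta w .$$ Call $c>0$ a Poincaré constant if $c\,\|v\|_{L^2(\Omega)}^2\le\|\nabla v\|_{L^2(\Omega)}^2$ for all $v\in H^1_{\Gamma_0}(\Omega)$. Let $F:\mathbb R\to\mathbb R$, $\tau>0$, $u\in L^2(0,\tau)$, $r\in L^2(\Omega)$ and $w_0\in L^2(\Omega)$. A strict solution on $[0,\tau]$ of the nonlinear heat equation $$\frac{\partial w}{\partial t}(\xi,t)=\Delta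 w(\xi,t)+F(w(\xi,t))+r(\xi)u(t)\ \text{ in }\Omega,\qquad w=0\text{ on }\Gamma_0,\qquad \frac{\partial w}{\partial\nu}=0\text{ on }\Gamma_1,\qquad w(\cdot,0)=w_0,$$ is a function $w\in W^{1,2}(0,\tau;L^2(\Omega))\cap L^2(0,\tau;D(\mathcal A))$ (with its representative continuous into $L^2(\Omega)$; $D(\mathcal A)$ carries the graph norm) such that $w(0)=w_0$ and, for almost every $t\in[0,\tau]$, $\dot w(t)=\mathcal A w(t)+F(w(t))+u(t)\,r$ in $L^2(\Omega)$. Then a Poincaré constant exists. Moreover, for every Poincaré constant $c_\Omega$ (which depends only on $\Omega$ and $\Gamma_0$), every $F$ with $\zeta F(\zeta)\le 0$ for all $\zeta\in\mathbb R$, and all $\tau,u,r,w_0$ as above, every strict solution $w$ satisfies $$\|w(\tau)\|_{L^2(\Omega)}^2\le\|w_0\|_{L^2(\Omega)}^2+\frac{4}{c_\Omega}\,\|u\|_{L^2(0,\tau)}^2\,\|r\|_{L^2(\Omega)}^2 .$$ -/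

import Mathlib

open MeasureTheory Set Filter Topology
open scoped ContDiff MeasureTheory

/-- The Euclidean plane `ℝ²`. -/
abbrev Plane : Type := EuclideanSpace ℝ (Fin 2)

/-- The Hilbert space `L²(Ω)` of real-valued functions. -/
abbrev L2 (Ω : Set Plane) : Type := Lp ℝ 2 (volume.restrict Ω)

/-- Arc length (one-dimensional Hausdorff measure) on the boundary of `Ω`. -/
noncomputable abbrev boundaryMeasure (Ω : Set Plane) : Measure Plane :=
  (μH[1] : Measure Plane).restrict (frontier Ω)

/-- The classical `i`-th partial derivative of a function on the plane. -/
noncomputable def partialDeriv (i : Fin 2) (φ : Plane → ℝ) (x : Plane) : ℝ :=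
  fderiv ℝ φ x (EuclideanSpace.single i 1)

/-- `Ω` has a Lipschitz boundary: near each boundary point, in suitable orthonormal coordinates,
`Ω` is the set of points lying strictly on one side of the graph of a Lipschitz function. -/
def HasLipschitzBoundary (Ω : Set Plane) : Prop :=
  ∀ p ∈ frontier Ω, ∃ (e : Plane ≃ₗᵢ[ℝ] Plane) (γ : ℝ → ℝ) (K : NNReal) (ρ : ℝ),
    0 < ρ ∧ LipschitzWith K γ ∧
      ∀ y ∈ Metric.ball p ρ, (y ∈ Ω ↔ γ (e (y - p) 0) < e (y - p) 1)

/-- `ν` is the unit outward normal of `Ω` at the boundary point `x`: blowing up at `x`, the set `Ω`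
becomes the open half-plane `{z | ⟪z, ν⟫ < 0}`.  For a Lipschitz boundary such a `ν` exists at
almost every boundary point (wherever the local graph function is differentiable); it is unique. -/
def IsOutwardNormal (Ω : Set Plane) (x ν : Plane) : Prop :=
  ‖ν‖ = 1 ∧ ∀ ε : ℝ, 0 < ε → ∀ᶠ y in 𝓝 x,
    (ε * ‖y - x‖ < inner ℝ (y - x) ν → y ∉ Ω) ∧
    (inner ℝ (y - x) ν < -(ε * ‖y - x‖) → y ∈ Ω)

/-- `g` is the weak `i`-th partial derivative of `v` in `Ω`. -/
def IsWeakPartial (Ω : Set Plane) (i : Fin 2) (v g : L2 Ω) : Prop :=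
  ∀ φ : Plane → ℝ, ContDiff ℝ ∞ φ → HasCompactSupport φ → tsupport φ ⊆ Ω →
    ∫ x in Ω, v x * partialDeriv i φ x = -∫ x in Ω, g x * φ x

/-- `G` is the weak gradient of `v`, with square-integrable components. -/
def IsWeakGradient (Ω : Set Plane) (v : L2 Ω) (G : Fin 2 → L2 Ω) : Prop :=
  ∀ i, IsWeakPartial Ω i v (G i)

/-- The Sobolev space `H¹(Ω)`. -/
def sobolevH1 (Ω : Set Plane) : Set (L2 Ω) :=
  {v | ∃ G, IsWeakGradient Ω v G}

/-- The Sobolev space `H²(Ω)`. -/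
def sobolevH2 (Ω : Set Plane) : Set (L2 Ω) :=
  {v | ∃ G, IsWeakGradient Ω v G ∧ ∀ i, G i ∈ sobolevH1 Ω}

/-- `g` is the boundary trace of `v ∈ H¹(Ω)`.  The trace operator `H¹(Ω) → L²(∂Ω)` is the continuous
extension of `φ ↦ φ|_{∂Ω}` from smooth functions on the plane: `v` is the limit in `H¹(Ω)` of smooth
functions whose boundary values converge to `g` in `L²(∂Ω)`. -/
def IsTrace (Ω : Set Plane) (v : L2 Ω) (g : Lp ℝ 2 (boundaryMeasure Ω)) : Prop :=
  ∃ (G : Fin 2 → L2 Ω) (φ : ℕ → Plane → ℝ),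
    IsWeakGradient Ω v G ∧
    (∀ n, ContDiff ℝ ∞ (φ n)) ∧
    Tendsto (fun n => eLpNorm (fun x => φ n x - v x) 2 (volume.restrict Ω)) atTop (𝓝 0) ∧
    (∀ i, Tendsto (fun n => eLpNorm (fun x => partialDeriv i (φ n) x - G i x) 2
      (volume.restrict Ω)) atTop (𝓝 0)) ∧
    Tendsto (fun n => eLpNorm (fun x => φ n x - g x) 2 (boundaryMeasure Ω)) atTop (𝓝 0)

/-- The space `H¹_{Γ₀}(Ω)` of all `v ∈ H¹(Ω)` whose trace vanishes on `Γ₀`. -/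
def sobolevH1Dirichlet (Ω Γ₀ : Set Plane) : Set (L2 Ω) :=
  {v | v ∈ sobolevH1 Ω ∧ ∃ g, IsTrace Ω v g ∧ ∀ᵐ x ∂(boundaryMeasure Ω), x ∈ Γ₀ → g x = 0}

/-- `∂w/∂ν = 0` on `Γ₁` for `w ∈ H²(Ω)`, where `∂w/∂ν` is the scalar product of the trace of the
gradient of `w` with the outward normal. -/
def NormalDerivVanishesOn (Ω Γ₁ : Set Plane) (w : L2 Ω) : Prop :=
  ∃ (G : Fin 2 → L2 Ω) (h : Fin 2 → Lp ℝ 2 (boundaryMeasure Ω)),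
    IsWeakGradient Ω w G ∧ (∀ i, IsTrace Ω (G i) (h i)) ∧
    ∀ᵐ x ∂(boundaryMeasure Ω), x ∈ Γ₁ → ∀ ν, IsOutwardNormal Ω x ν → ∑ i, h i x * ν i = 0

/-- The domain `D(𝒜) = {w ∈ H²(Ω) ∩ H¹_{Γ₀}(Ω) : ∂w/∂ν = 0 on Γ₁}` of the operator `𝒜 w = Δ w`. -/
def heatDomain (Ω Γ₀ Γ₁ : Set Plane) : Set (L2 Ω) :=
  {w | w ∈ sobolevH2 Ω ∧ w ∈ sobolevH1Dirichlet Ω Γ₀ ∧ NormalDerivVanishesOn Ω Γ₁ w}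

/-- `f = Δ w`, with weak second derivatives in `L²(Ω)`. -/
def IsLaplacian (Ω : Set Plane) (w f : L2 Ω) : Prop :=
  ∃ G H : Fin 2 → L2 Ω, IsWeakGradient Ω w G ∧
    (∀ i, IsWeakPartial Ω i (G i) (H i)) ∧ f = ∑ i, H i

/-- `w` is a strict solution on `[0, τ]` of
`∂w/∂t = Δ w + F(w) + r(ξ) u(t)`, `w = 0` on `Γ₀`, `∂w/∂ν = 0` on `Γ₁`, `w(0) = w₀`:
`w ∈ W^{1,2}(0,τ; L²(Ω)) ∩ L²(0,τ; D(𝒜))` (`w'` is the time derivative, `Aw` is `𝒜 w`), and the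
differential equation holds for almost every time. -/
def IsStrictSolution (Ω Γ₀ Γ₁ : Set Plane) (F : ℝ → ℝ) (τ : ℝ)
    (u : Lp ℝ 2 (volume.restrict (Icc (0 : ℝ) τ))) (r w₀ : L2 Ω) (w : ℝ → L2 Ω) : Prop :=
  ∃ w' Aw : ℝ → L2 Ω,
    MemLp w' 2 (volume.restrict (Icc (0 : ℝ) τ)) ∧
    (∀ t ∈ Icc (0 : ℝ) τ, w t = w₀ + ∫ s in (0 : ℝ)..t, w' s) ∧
    MemLp Aw 2 (volume.restrict (Icc (0 : ℝ) τ)) ∧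
    ∀ᵐ t ∂(volume.restrict (Icc (0 : ℝ) τ)),
      w t ∈ heatDomain Ω Γ₀ Γ₁ ∧ IsLaplacian Ω (w t) (Aw t) ∧
      ∀ᵐ ξ ∂(volume.restrict Ω), w' t ξ = Aw t ξ + F (w t ξ) + r ξ * u t

/-- `c` is a Poincaré constant of `H¹_{Γ₀}(Ω)`: `c ‖v‖² ≤ ‖∇v‖²` for all `v ∈ H¹_{Γ₀}(Ω)`. -/
def IsPoincareConstant (Ω Γ₀ : Set Plane) (c : ℝ) : Prop :=
  0 < c ∧ ∀ v ∈ sobolevH1Dirichlet Ω Γ₀, ∀ G, IsWeakGradient Ω v G →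
    c * ‖v‖ ^ 2 ≤ ∑ i, ‖G i‖ ^ 2

/-!
The Poincaré inequality and the energy estimate both rest on writing `Ω`, near any point of its
closure, as the epigraph of a Lipschitz function `γ` in an orthonormal frame (`IsGraphChart`).

*Poincaré constant.* Call two measures linked (`PoincareLinked`) when the mean square difference of
the values of a smooth function under one and the other is bounded by its Dirichlet energy on `Ω`.
Links are symmetric, and they compose through any nonzero finite measure. In a chart, a vertical
segment followed by a horizontal one joins a point of `Ω`, or of the graph, to a fixed rectangle, so
the one-dimensional fundamental theorem of calculus links Lebesgue measure near the point, and the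
boundary measure carried by the graph, to that rectangle (`poincareLinked_frame`). Connectedness of
`Ω` and compactness of its closure then link `Ω` to itself (`poincareLinked_self`) and to a piece of
boundary charging `Γ₀` (`exists_boundary_poincareLinked`). Since the trace vanishes on `Γ₀`, passing
to the limit along smooth approximations gives the inequality. No compact embedding is needed.

*Green's formula.* In a chart the divergence theorem is Fubini's theorem after a shear, combined
with the vanishing of the integral of the derivative of a compactly supported Lipschitz function. It
is written with the parameter measure on the graph and the normal `(γ', -1)` that is not normalized
(`IsGraphChart.setIntegral_partialDeriv`). The parameter measure is at most arc length, because
projections do not increase Hausdorff measure (`IsGraphChart.map_graphMap_le`); so traces can be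
inserted by a limit, and no area formula is used. On the domain of the Laplacian the boundary
integrand is zero almost everywhere, and a partition of unity yields `⟪w, Δw⟫ = -‖∇w‖²`
(`inner_laplacian_eq`).

*Energy.* `‖w(t)‖²` is absolutely continuous with derivative `2⟪w, w'⟫`
(`norm_sq_eq_add_integral_inner`). The equation, `ζ F(ζ) ≤ 0`, Green's formula and the Poincaré
constant `c` give `2⟪w, w'⟫ ≤ -2c‖w‖² + 2|u|‖w‖‖r‖ ≤ u²‖r‖²/(2c)` (`inner_deriv_le`). Integration
gives the estimate, with `1/(2c)` in place of `4/c`.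
-/

open scoped ENNReal NNReal

/-! ### Poincaré links between measures -/

/-- Two measures on the plane are *linked* through `Ω` when the mean square difference of the
values of a smooth function under one and the other is controlled by its Dirichlet energy on `Ω`. -/
def PoincareLinked (Ω : Set Plane) (μ ν : Measure Plane) : Prop :=
  ∃ C : ℝ≥0∞, C ≠ ⊤ ∧ ∀ φ : Plane → ℝ, ContDiff ℝ ∞ φ →
    ∫⁻ x, ∫⁻ y, ‖φ x - φ y‖ₑ ^ 2 ∂ν ∂μ ≤ C * ∫⁻ x in Ω, ‖fderiv ℝ φ x‖ₑ ^ 2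

theorem enorm_sq_eq_ofReal (a : ℝ) : ‖a‖ₑ ^ 2 = ENNReal.ofReal (a ^ 2) := by
  rw [← sq_abs, ENNReal.ofReal_pow (abs_nonneg a), ← Real.enorm_eq_ofReal_abs]

theorem enorm_sub_sq_le (a b c : ℝ) :
    ‖a - c‖ₑ ^ 2 ≤ 2 * (‖a - b‖ₑ ^ 2 + ‖b - c‖ₑ ^ 2) := by
  simp only [enorm_sq_eq_ofReal]
  rw [← ENNReal.ofReal_add (by positivity) (by positivity), ← ENNReal.ofReal_ofNat 2,
    ← ENNReal.ofReal_mul (by positivity)]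
  apply ENNReal.ofReal_le_ofReal
  nlinarith [sq_nonneg (a - b - (b - c))]

namespace PoincareLinked

variable {Ω : Set Plane} {μ μ' ν ν' κ : Measure Plane}

theorem symm [SFinite μ] [SFinite ν] (h : PoincareLinked Ω μ ν) : PoincareLinked Ω ν μ := by
  obtain ⟨C, hC, h⟩ := h
  refine ⟨C, hC, fun φ hφ => ?_⟩
  have hc := hφ.continuous
  rw [lintegral_lintegral_swap (by fun_prop)]
  simp_rw [← enorm_neg (φ _ - φ _), neg_sub]
  exact h φ hφ

theorem mono (h : PoincareLinked Ω μ ν) (hμ : μ' ≤ μ) (hν : ν' ≤ ν) :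
    PoincareLinked Ω μ' ν' := by
  obtain ⟨C, hC, h⟩ := h
  exact ⟨C, hC, fun φ hφ =>
    (lintegral_mono' hμ fun x => lintegral_mono' hν le_rfl).trans (h φ hφ)⟩

theorem add (h : PoincareLinked Ω μ ν) (h' : PoincareLinked Ω μ' ν) :
    PoincareLinked Ω (μ + μ') ν := by
  obtain ⟨C, hC, h⟩ := h
  obtain ⟨C', hC', h'⟩ := h'
  refine ⟨C + C', ENNReal.add_ne_top.2 ⟨hC, hC'⟩, fun φ hφ => ?_⟩
  rw [lintegral_add_measure, add_mul]
  exact add_le_add (h φ hφ) (h' φ hφ)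

/-- Links compose through a nonzero measure, by averaging the triangle inequality over it. -/
theorem trans [IsFiniteMeasure μ] [IsFiniteMeasure ν] [IsFiniteMeasure κ] (hν : ν ≠ 0)
    (h : PoincareLinked Ω μ ν) (h' : PoincareLinked Ω ν κ) : PoincareLinked Ω μ κ := by
  obtain ⟨C, hC, h⟩ := h
  obtain ⟨C', hC', h'⟩ := h'
  have hν0 : ν univ ≠ 0 := by simpa using hν
  refine ⟨(ν univ)⁻¹ * (2 * (κ univ * C + μ univ * C')), ?_, fun φ hφ => ?_⟩
  · have := measure_ne_top κ univ
    have := measure_ne_top μ univ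
    finiteness
  have hc := hφ.continuous
  have key : ν univ * ∫⁻ x, ∫⁻ z, ‖φ x - φ z‖ₑ ^ 2 ∂κ ∂μ ≤
      2 * (κ univ * ∫⁻ x, ∫⁻ y, ‖φ x - φ y‖ₑ ^ 2 ∂ν ∂μ +
        μ univ * ∫⁻ y, ∫⁻ z, ‖φ y - φ z‖ₑ ^ 2 ∂κ ∂ν) := by
    have m1 : Measurable fun y => ∫⁻ z, ‖φ y - φ z‖ₑ ^ 2 ∂κ :=
      Measurable.lintegral_prod_right' (f := fun p : Plane × Plane => ‖φ p.1 - φ p.2‖ₑ ^ 2)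
        (by fun_prop)
    have m2 : Measurable fun y => ∫⁻ z, ‖φ y - φ z‖ₑ ^ 2 ∂ν :=
      Measurable.lintegral_prod_right' (f := fun p : Plane × Plane => ‖φ p.1 - φ p.2‖ₑ ^ 2)
        (by fun_prop)
    calc ν univ * ∫⁻ x, ∫⁻ z, ‖φ x - φ z‖ₑ ^ 2 ∂κ ∂μ
        = ∫⁻ x, ∫⁻ _, ∫⁻ z, ‖φ x - φ z‖ₑ ^ 2 ∂κ ∂ν ∂μ := by
          simp_rw [lintegral_const]
          rw [lintegral_mul_const _ m1, mul_comm]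
      _ ≤ ∫⁻ x, ∫⁻ y, ∫⁻ z, 2 * (‖φ x - φ y‖ₑ ^ 2 + ‖φ y - φ z‖ₑ ^ 2) ∂κ ∂ν ∂μ :=
          lintegral_mono fun x => lintegral_mono fun y => lintegral_mono fun z =>
            enorm_sub_sq_le _ _ _
      _ = ∫⁻ x, ∫⁻ y, 2 * (κ univ * ‖φ x - φ y‖ₑ ^ 2 + ∫⁻ z, ‖φ y - φ z‖ₑ ^ 2 ∂κ) ∂ν ∂μ := by
          refine lintegral_congr fun x => lintegral_congr fun y => ?_
          rw [lintegral_const_mul _ (by fun_prop), lintegral_add_left (by fun_prop),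
            lintegral_const, mul_comm (κ univ)]
      _ = ∫⁻ x, 2 * (κ univ * ∫⁻ y, ‖φ x - φ y‖ₑ ^ 2 ∂ν +
            ∫⁻ y, ∫⁻ z, ‖φ y - φ z‖ₑ ^ 2 ∂κ ∂ν) ∂μ := by
          refine lintegral_congr fun x => ?_
          rw [lintegral_const_mul _ (by fun_prop), lintegral_add_left (by fun_prop),
            lintegral_const_mul _ (by fun_prop)]
      _ = _ := by
          rw [lintegral_const_mul _ (by fun_prop), lintegral_add_left (by fun_prop),
            lintegral_const_mul _ (by fun_prop), lintegral_const, mul_comm (μ univ)]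
  calc ∫⁻ x, ∫⁻ z, ‖φ x - φ z‖ₑ ^ 2 ∂κ ∂μ
      = (ν univ)⁻¹ * (ν univ * ∫⁻ x, ∫⁻ z, ‖φ x - φ z‖ₑ ^ 2 ∂κ ∂μ) := by
        rw [← mul_assoc, ENNReal.inv_mul_cancel hν0 (measure_ne_top ν univ), one_mul]
    _ ≤ (ν univ)⁻¹ * (2 * (κ univ * (C * ∫⁻ x in Ω, ‖fderiv ℝ φ x‖ₑ ^ 2) +
          μ univ * (C' * ∫⁻ x in Ω, ‖fderiv ℝ φ x‖ₑ ^ 2))) := by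
        grw [key, h φ hφ, h' φ hφ]
    _ = _ := by ring

end PoincareLinked

/-! ### Orthonormal charts of the plane -/

/-- The point with coordinates `z` in the orthonormal frame at `p` given by the isometry `e`. -/
noncomputable def frameMap (p : Plane) (e : Plane ≃ₗᵢ[ℝ] Plane) (z : ℝ × ℝ) : Plane :=
  p + e.symm !₂[z.1, z.2]

section Frame

variable (p : Plane) (e : Plane ≃ₗᵢ[ℝ] Plane)

@[simp] theorem frameMap_coord_zero (z : ℝ × ℝ) : e (frameMap p e z - p) 0 = z.1 := by
  simp [frameMap]

@[simp] theorem frameMap_coord_one (z : ℝ × ℝ) : e (frameMap p e z - p) 1 = z.2 := by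
  simp [frameMap]

theorem frameMap_coords (y : Plane) : frameMap p e (e (y - p) 0, e (y - p) 1) = y := by
  have : (!₂[e (y - p) 0, e (y - p) 1] : Plane) = e (y - p) := by
    ext i; fin_cases i <;> rfl
  rw [frameMap, this, LinearIsometryEquiv.symm_apply_apply, add_sub_cancel]

theorem frameMap_sub_frameMap (z z' : ℝ × ℝ) :
    frameMap p e z - frameMap p e z' = e.symm !₂[z.1 - z'.1, z.2 - z'.2] := by
  simp only [frameMap, add_sub_add_left_eq_sub, ← map_sub]
  congr 1
  ext i; fin_cases i <;> simp

theorem norm_vec_le (a b : ℝ) : ‖(!₂[a, b] : Plane)‖ ≤ |a| + |b| := by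
  rw [EuclideanSpace.norm_eq]
  simp only [Fin.sum_univ_two]
  apply Real.sqrt_le_iff.2 ⟨by positivity, _⟩
  have h1 := abs_nonneg a
  have h2 := abs_nonneg b
  simp
  nlinarith [sq_abs a, sq_abs b]

theorem norm_frameMap_sub_le (z : ℝ × ℝ) : ‖frameMap p e z - p‖ ≤ |z.1| + |z.2| := by
  simpa [frameMap] using norm_vec_le z.1 z.2

theorem abs_coord_le (x : Plane) (i : Fin 2) : |x i| ≤ ‖x‖ := by
  simpa using PiLp.norm_apply_le x i

@[fun_prop]
theorem continuous_frameMap : Continuous (frameMap p e) := by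
  unfold frameMap
  fun_prop

theorem continuous_coord (i : Fin 2) : Continuous fun y : Plane => e (y - p) i := by
  fun_prop

/-- The frame map as a homeomorphism. -/
noncomputable def frameHomeomorph : ℝ × ℝ ≃ₜ Plane where
  toFun := frameMap p e
  invFun y := (e (y - p) 0, e (y - p) 1)
  left_inv z := Prod.ext (frameMap_coord_zero p e z) (frameMap_coord_one p e z)
  right_inv y := frameMap_coords p e y
  continuous_toFun := continuous_frameMap p e
  continuous_invFun := (continuous_coord p e 0).prodMk (continuous_coord p e 1)

theorem measurableEmbedding_frameMap : MeasurableEmbedding (frameMap p e) :=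
  (frameHomeomorph p e).measurableEmbedding

theorem measurePreserving_frameMap : MeasurePreserving (frameMap p e) := by
  have h1 : MeasurePreserving (fun z : ℝ × ℝ => (![z.1, z.2] : Fin 2 → ℝ)) :=
    (volume_preserving_finTwoArrow ℝ).symm _
  have h2 := (PiLp.volume_preserving_toLp (Fin 2)).comp h1
  have h3 := e.symm.measurePreserving.comp h2
  exact (measurePreserving_add_left volume p).comp h3

/-- The partial derivative in the first coordinate of the frame. -/
theorem hasDerivAt_frameMap_fst {φ : Plane → ℝ} (hφ : Differentiable ℝ φ) (s t : ℝ) :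
    HasDerivAt (fun s => φ (frameMap p e (s, t)))
      (fderiv ℝ φ (frameMap p e (s, t)) (e.symm !₂[1, 0])) s := by
  have h : HasDerivAt (fun s => frameMap p e (s, t)) (e.symm !₂[1, 0]) s := by
    have : (fun s => frameMap p e (s, t)) =
        fun s => (p + e.symm !₂[0, t]) + s • e.symm !₂[1, 0] := by
      ext1 s
      simp only [frameMap, add_assoc, ← map_smul, ← map_add]
      congr 2
      ext i; fin_cases i <;> simp
    rw [this]
    simpa using ((hasDerivAt_id s).smul_const (e.symm !₂[1, 0])).const_add (p + e.symm !₂[0, t])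
  exact (hφ _).hasFDerivAt.comp_hasDerivAt s h

/-- The partial derivative in the second coordinate of the frame. -/
theorem hasDerivAt_frameMap_snd {φ : Plane → ℝ} (hφ : Differentiable ℝ φ) (s t : ℝ) :
    HasDerivAt (fun t => φ (frameMap p e (s, t)))
      (fderiv ℝ φ (frameMap p e (s, t)) (e.symm !₂[0, 1])) t := by
  have h : HasDerivAt (fun t => frameMap p e (s, t)) (e.symm !₂[0, 1]) t := by
    have : (fun t => frameMap p e (s, t)) =
        fun t => (p + e.symm !₂[s, 0]) + t • e.symm !₂[0, 1] := by
      ext1 s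
      simp only [frameMap, add_assoc, ← map_smul, ← map_add]
      congr 2
      ext i; fin_cases i <;> simp
    rw [this]
    simpa using ((hasDerivAt_id t).smul_const (e.symm !₂[0, 1])).const_add (p + e.symm !₂[s, 0])
  exact (hφ _).hasFDerivAt.comp_hasDerivAt t h

theorem norm_symm_vec_one_zero : ‖e.symm (!₂[1, 0] : Plane)‖ = 1 := by
  simp [EuclideanSpace.norm_eq]

theorem norm_symm_vec_zero_one : ‖e.symm (!₂[0, 1] : Plane)‖ = 1 := by
  simp [EuclideanSpace.norm_eq]

end Frame

/-! ### Links between measures in a graph chart -/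

theorem lintegral_sq_le_measure_univ_mul {α : Type*} [MeasurableSpace α] {μ : Measure α}
    {f : α → ℝ≥0∞} (hf : AEMeasurable f μ) :
    (∫⁻ a, f a ∂μ) ^ 2 ≤ μ univ * ∫⁻ a, f a ^ 2 ∂μ := by
  have h := ENNReal.lintegral_mul_le_Lp_mul_Lq μ Real.HolderConjugate.two_two
    (aemeasurable_const (b := (1 : ℝ≥0∞))) hf
  simp only [Pi.mul_apply, one_mul, ENNReal.rpow_ofNat, one_pow, lintegral_one] at h
  calc (∫⁻ a, f a ∂μ) ^ 2
      ≤ (μ univ ^ (1 / 2 : ℝ) * (∫⁻ a, f a ^ 2 ∂μ) ^ (1 / 2 : ℝ)) ^ 2 := by grw [h]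
    _ = _ := by
      rw [mul_pow, ← ENNReal.rpow_mul_natCast, ← ENNReal.rpow_mul_natCast]
      norm_num

theorem enorm_sub_sq_le_lintegral_deriv {g g' : ℝ → ℝ} (hg : ∀ t, HasDerivAt g (g' t) t)
    (hg' : Continuous g') {c d x y : ℝ} (hx : x ∈ Icc c d) (hy : y ∈ Icc c d) :
    ‖g x - g y‖ₑ ^ 2 ≤ ENNReal.ofReal (d - c) * ∫⁻ t in Ioo c d, ‖g' t‖ₑ ^ 2 := by
  have h1 : ‖g x - g y‖ₑ ≤ ∫⁻ t in Ioo c d, ‖g' t‖ₑ := by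
    rw [← intervalIntegral.integral_eq_sub_of_hasDerivAt (fun t _ => hg t)
      (hg'.intervalIntegrable _ _), restrict_Ioo_eq_restrict_Ioc,
      enorm_eq_iff_norm_eq.2 (intervalIntegral.norm_intervalIntegral_eq g' y x volume)]
    refine (enorm_integral_le_lintegral_enorm _).trans (lintegral_mono_set ?_)
    exact Ioc_subset_Ioc (le_min hy.1 hx.1) (max_le hy.2 hx.2)
  calc ‖g x - g y‖ₑ ^ 2 ≤ (∫⁻ t in Ioo c d, ‖g' t‖ₑ) ^ 2 := by grw [h1]
    _ ≤ _ := by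
      refine (lintegral_sq_le_measure_univ_mul (by fun_prop)).trans ?_
      simp

theorem enorm_fderiv_apply_sq_le {φ : Plane → ℝ} {v : Plane} (hv : ‖v‖ = 1) (x : Plane) :
    ‖fderiv ℝ φ x v‖ₑ ^ 2 ≤ ‖fderiv ℝ φ x‖ₑ ^ 2 := by
  have h : ‖fderiv ℝ φ x v‖ₑ ≤ ‖fderiv ℝ φ x‖ₑ := by
    have := (fderiv ℝ φ x).le_opNorm v
    rw [hv, mul_one] at this
    exact enorm_le_iff_norm_le.2 this
  gcongr

/-- In the coordinates of a frame, let the region between the graph of `γ` and the height `b` over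
an interval lie in `Ω`. A measure on this region whose horizontal marginal is bounded by Lebesgue
measure is linked to the Lebesgue measure of the top rectangle: two points are joined by a vertical
segment up to the rectangle followed by a horizontal segment inside it. -/
theorem poincareLinked_frame {Ω : Set Plane} (hΩ : IsOpen Ω) (p : Plane) (e : Plane ≃ₗᵢ[ℝ] Plane)
    {a b δ L : ℝ} {γ : ℝ → ℝ}
    (hlow : ∀ s ∈ Ioo (-a) a, b - L ≤ γ s) (hup : ∀ s ∈ Ioo (-a) a, γ s ≤ b - δ)
    (hU : ∀ s ∈ Ioo (-a) a, ∀ t, γ s < t → t < b → frameMap p e (s, t) ∈ Ω)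
    (μ : Measure (ℝ × ℝ)) [IsFiniteMeasure μ]
    (hμ : ∀ᵐ z ∂μ, z.1 ∈ Ioo (-a) a ∧ γ z.1 ≤ z.2 ∧ z.2 < b)
    {B : ℝ≥0∞} (hB : B ≠ ⊤) (hfst : μ.map Prod.fst ≤ B • volume) :
    PoincareLinked Ω (μ.map (frameMap p e))
      ((volume.restrict (Ioo (-a) a ×ˢ Ioo (b - δ) b)).map (frameMap p e)) := by
  set R := Ioo (-a) a ×ˢ Ioo (b - δ) b with hR
  set A := ENNReal.ofReal (2 * a)
  have hRfin : volume R ≠ ⊤ := by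
    rw [hR, Measure.volume_eq_prod, Measure.prod_prod]
    simp only [Real.volume_Ioo]
    finiteness
  refine ⟨2 * (ENNReal.ofReal L * volume R * B + μ univ * (A * A)), ?_, fun φ hφ => ?_⟩
  · have := measure_ne_top μ univ
    finiteness
  have hκ := measurableEmbedding_frameMap p e
  simp only [hκ.lintegral_map]
  have hdiff : Differentiable ℝ φ := hφ.differentiable (by simp)
  have hcf : Continuous (fderiv ℝ φ) := hφ.continuous_fderiv (by simp)
  -- The energy density in frame coordinates, cut off outside `Ω`.
  set h : ℝ × ℝ → ℝ≥0∞ :=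
    (frameMap p e ⁻¹' Ω).indicator fun z => ‖fderiv ℝ φ (frameMap p e z)‖ₑ ^ 2 with hh
  have hΩm : MeasurableSet (frameMap p e ⁻¹' Ω) := hκ.measurable hΩ.measurableSet
  have hm : Measurable h := Measurable.indicator (by fun_prop) hΩm
  have hE : ∫⁻ z, h z = ∫⁻ x in Ω, ‖fderiv ℝ φ x‖ₑ ^ 2 := by
    rw [lintegral_indicator hΩm, (measurePreserving_frameMap p e).setLIntegral_comp_preimage_emb hκ
      (fun x => ‖fderiv ℝ φ x‖ₑ ^ 2)]
  set H₁ : ℝ → ℝ≥0∞ := fun s => ∫⁻ t, h (s, t) with hH₁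
  set H₂ : ℝ → ℝ≥0∞ := fun t => ∫⁻ s, h (s, t) with hH₂
  have hm₁ : Measurable H₁ := hm.lintegral_prod_right'
  have hm₂ : Measurable H₂ := hm.lintegral_prod_left'
  have hE₁ : ∫⁻ s, H₁ s = ∫⁻ z, h z := by
    rw [Measure.volume_eq_prod, lintegral_prod _ hm.aemeasurable]
  have hE₂ : ∫⁻ t, H₂ t = ∫⁻ z, h z := by
    rw [Measure.volume_eq_prod, lintegral_prod_symm _ hm.aemeasurable]
  have pt : ∀ z : ℝ × ℝ, (z.1 ∈ Ioo (-a) a ∧ γ z.1 ≤ z.2 ∧ z.2 < b) → ∀ z' ∈ R,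
      ‖φ (frameMap p e z) - φ (frameMap p e z')‖ₑ ^ 2 ≤
        2 * (ENNReal.ofReal L * H₁ z.1 + A * H₂ z'.2) := by
    rintro ⟨s, t⟩ ⟨hs, ht, htb⟩ ⟨s', t'⟩ ⟨hs', ht'⟩
    dsimp only at hs ht htb hs' ht' ⊢
    have e1 : ‖φ (frameMap p e (s, t)) - φ (frameMap p e (s, t'))‖ₑ ^ 2 ≤
        ENNReal.ofReal L * H₁ s := by
      refine (enorm_sub_sq_le_lintegral_deriv
        (fun t => hasDerivAt_frameMap_snd p e hdiff s t) (by fun_prop)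
        ⟨ht, htb.le⟩ ⟨(hup s hs).trans ht'.1.le, ht'.2.le⟩).trans ?_
      refine mul_le_mul' (ENNReal.ofReal_le_ofReal (by linarith [hlow s hs])) ?_
      rw [hH₁, ← lintegral_indicator measurableSet_Ioo]
      refine lintegral_mono fun τ => ?_
      refine indicator_apply_le' (fun hτ => ?_) fun _ => zero_le
      simp only [hh]
      rw [indicator_of_mem (show (s, τ) ∈ frameMap p e ⁻¹' Ω from hU s hs τ hτ.1 hτ.2)]
      exact enorm_fderiv_apply_sq_le (norm_symm_vec_zero_one e) _
    have e2 : ‖φ (frameMap p e (s, t')) - φ (frameMap p e (s', t'))‖ₑ ^ 2 ≤ A * H₂ t' := by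
      refine (enorm_sub_sq_le_lintegral_deriv
        (fun s => hasDerivAt_frameMap_fst p e hdiff s t') (by fun_prop)
        (Ioo_subset_Icc_self hs) (Ioo_subset_Icc_self hs')).trans ?_
      refine mul_le_mul' (ENNReal.ofReal_le_ofReal (by linarith)) ?_
      rw [hH₂, ← lintegral_indicator measurableSet_Ioo]
      refine lintegral_mono fun σ => ?_
      refine indicator_apply_le' (fun hσ => ?_) fun _ => zero_le
      simp only [hh]
      rw [indicator_of_mem (show (σ, t') ∈ frameMap p e ⁻¹' Ω from
        hU σ hσ t' ((hup σ hσ).trans_lt ht'.1) ht'.2)]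
      exact enorm_fderiv_apply_sq_le (norm_symm_vec_one_zero e) _
    grw [enorm_sub_sq_le _ (φ (frameMap p e (s, t'))) _, e1, e2]
  have i₁ : ∫⁻ z, H₁ z.1 ∂μ ≤ B * ∫⁻ z, h z := by
    rw [← lintegral_map hm₁ measurable_fst, ← hE₁, ← smul_eq_mul,
      ← lintegral_smul_measure]
    exact lintegral_mono' hfst le_rfl
  have i₂ : ∫⁻ z' in R, H₂ z'.2 ≤ A * ∫⁻ z, h z := by
    rw [← hE₂, hR, Measure.volume_eq_prod, ← Measure.prod_restrict,
      lintegral_prod _ (by fun_prop)]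
    simp only [lintegral_const, Measure.restrict_apply_univ, Real.volume_Ioo, sub_neg_eq_add]
    rw [← two_mul, mul_comm]
    gcongr
    exact Measure.restrict_le_self
  calc ∫⁻ z, ∫⁻ z' in R, ‖φ (frameMap p e z) - φ (frameMap p e z')‖ₑ ^ 2 ∂volume ∂μ
      ≤ ∫⁻ z, ∫⁻ z' in R, 2 * (ENNReal.ofReal L * H₁ z.1 + A * H₂ z'.2) ∂volume ∂μ := by
        refine lintegral_mono_ae (hμ.mono fun z hz => ?_)
        exact setLIntegral_mono (by fun_prop) (pt z hz)
    _ = 2 * (ENNReal.ofReal L * volume R * (∫⁻ z, H₁ z.1 ∂μ) +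
          μ univ * (A * ∫⁻ z' in R, H₂ z'.2)) := by
        have : ∀ z : ℝ × ℝ, ∫⁻ z' in R, 2 * (ENNReal.ofReal L * H₁ z.1 + A * H₂ z'.2) =
            2 * (ENNReal.ofReal L * volume R * H₁ z.1 + A * ∫⁻ z' in R, H₂ z'.2) := fun z => by
          rw [lintegral_const_mul _ (by fun_prop), lintegral_add_left (by fun_prop),
            lintegral_const, Measure.restrict_apply_univ, lintegral_const_mul _ (by fun_prop)]
          ring
        simp_rw [this]
        rw [lintegral_const_mul _ (by fun_prop), lintegral_add_left (by fun_prop),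
          lintegral_const_mul _ (by fun_prop), lintegral_const]
        ring
    _ ≤ 2 * (ENNReal.ofReal L * volume R * (B * ∫⁻ z, h z) +
          μ univ * (A * (A * ∫⁻ z, h z))) := by grw [i₁, i₂]
    _ = _ := by rw [hE]; ring

/-! ### Graph charts and the boundary measure -/

/-- In the ball of radius `ρ` at `p`, the set `Ω` is the strict epigraph of the Lipschitz function
`γ` in the frame `e`. The ball may lie inside `Ω`, so such charts exist at all points of the
closure. -/
structure IsGraphChart (Ω : Set Plane) (p : Plane) (e : Plane ≃ₗᵢ[ℝ] Plane) (γ : ℝ → ℝ)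
    (K : ℝ≥0) (ρ : ℝ) : Prop where
  pos : 0 < ρ
  lip : LipschitzWith K γ
  mem_iff : ∀ y ∈ Metric.ball p ρ, (y ∈ Ω ↔ γ (e (y - p) 0) < e (y - p) 1)

/-- The parametrization of the graph of `γ` in a frame. -/
noncomputable def graphMap (p : Plane) (e : Plane ≃ₗᵢ[ℝ] Plane) (γ : ℝ → ℝ) (s : ℝ) : Plane :=
  frameMap p e (s, γ s)

theorem exists_isGraphChart {Ω : Set Plane} (hΩ : IsOpen Ω) (hlip : HasLipschitzBoundary Ω)
    {p : Plane} (hp : p ∈ closure Ω) : ∃ e γ K ρ, IsGraphChart Ω p e γ K ρ := by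
  by_cases hpΩ : p ∈ Ω
  · obtain ⟨ρ, hρ, hball⟩ := Metric.isOpen_iff.1 hΩ p hpΩ
    refine ⟨LinearIsometryEquiv.refl ℝ Plane, fun _ => -ρ, 0, ρ, hρ, LipschitzWith.const _,
      fun y hy => iff_of_true (hball hy) ?_⟩
    have h := abs_coord_le (y - p) 1
    rw [mem_ball_iff_norm] at hy
    exact (abs_lt.1 (h.trans_lt hy)).1
  · obtain ⟨e, γ, K, ρ, h₁, h₂, h₃⟩ := hlip p (by rw [hΩ.frontier_eq]; exact ⟨hp, hpΩ⟩)
    exact ⟨e, γ, K, ρ, h₁, h₂, h₃⟩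

theorem lipschitzWith_graphMap (p : Plane) (e : Plane ≃ₗᵢ[ℝ] Plane) {γ : ℝ → ℝ} {K : ℝ≥0}
    (hγ : LipschitzWith K γ) : LipschitzWith (1 + K) (graphMap p e γ) := by
  refine LipschitzWith.of_dist_le_mul fun s t => ?_
  rw [dist_eq_norm, graphMap, graphMap, frameMap_sub_frameMap, LinearIsometryEquiv.norm_map]
  refine (norm_vec_le _ _).trans ?_
  have h := hγ.dist_le_mul s t
  rw [Real.dist_eq, Real.dist_eq] at *
  push_cast
  linarith

namespace IsGraphChart

variable {Ω : Set Plane} {p : Plane} {e : Plane ≃ₗᵢ[ℝ] Plane} {γ : ℝ → ℝ} {K : ℝ≥0} {ρ : ℝ}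

theorem continuous_graphMap (h : IsGraphChart Ω p e γ K ρ) : Continuous (graphMap p e γ) :=
  (lipschitzWith_graphMap p e h.lip).continuous

theorem frameMap_mem_iff (h : IsGraphChart Ω p e γ K ρ) {z : ℝ × ℝ}
    (hz : frameMap p e z ∈ Metric.ball p ρ) : frameMap p e z ∈ Ω ↔ γ z.1 < z.2 := by
  rw [h.mem_iff _ hz, frameMap_coord_zero, frameMap_coord_one]

theorem le_of_mem_closure (h : IsGraphChart Ω p e γ K ρ) {y : Plane} (hy : y ∈ Metric.ball p ρ)
    (hyΩ : y ∈ closure Ω) : γ (e (y - p) 0) ≤ e (y - p) 1 := by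
  by_contra! hlt
  have hγ := h.lip.continuous
  have h1 : ∀ᶠ z in 𝓝 y, e (z - p) 1 < γ (e (z - p) 0) :=
    (continuous_coord p e 1).continuousAt.eventually_lt
      (hγ.comp (continuous_coord p e 0)).continuousAt hlt
  obtain ⟨z, ⟨hz1, hz2⟩, hzΩ⟩ := mem_closure_iff_nhds.1 hyΩ _
    (inter_mem h1 (Metric.isOpen_ball.mem_nhds hy))
  exact lt_asymm ((h.mem_iff z hz2).1 hzΩ) hz1

theorem apply_zero_le (h : IsGraphChart Ω p e γ K ρ) (hp : p ∈ closure Ω) : γ 0 ≤ 0 := by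
  simpa using h.le_of_mem_closure (Metric.mem_ball_self h.pos) hp

theorem graphMap_mem_frontier (h : IsGraphChart Ω p e γ K ρ) (hΩ : IsOpen Ω) {s : ℝ}
    (hs : graphMap p e γ s ∈ Metric.ball p ρ) : graphMap p e γ s ∈ frontier Ω := by
  rw [hΩ.frontier_eq]
  refine ⟨?_, fun hmem => lt_irrefl _ ((h.frameMap_mem_iff hs).1 hmem)⟩
  have hc : Continuous fun t => frameMap p e (s, t) := by fun_prop
  have h1 : Tendsto (fun t => frameMap p e (s, t)) (𝓝[>] (γ s)) (𝓝 (graphMap p e γ s)) :=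
    hc.continuousAt.tendsto.mono_left nhdsWithin_le_nhds
  refine mem_closure_of_tendsto h1 ?_
  filter_upwards [h1 (Metric.isOpen_ball.mem_nhds hs), self_mem_nhdsWithin] with t ht1 ht2
  exact (h.frameMap_mem_iff ht1).2 ht2

theorem graphMap_coord_eq (h : IsGraphChart Ω p e γ K ρ) (hΩ : IsOpen Ω) {y : Plane}
    (hy : y ∈ Metric.ball p ρ) (hyΩ : y ∈ frontier Ω) :
    graphMap p e γ (e (y - p) 0) = y := by
  rw [hΩ.frontier_eq] at hyΩ
  have h1 := h.le_of_mem_closure hy hyΩ.1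
  have h2 := mt (h.mem_iff y hy).2 hyΩ.2
  rw [graphMap, le_antisymm h1 (not_lt.1 h2), frameMap_coords]

/-- Projecting the graph to its parameter shortens lengths, so the parameter measure is dominated
by arc length. This replaces the area formula. -/
theorem map_graphMap_le (h : IsGraphChart Ω p e γ K ρ) {J : Set ℝ}
    (hJ : ∀ s ∈ J, graphMap p e γ s ∈ frontier Ω) :
    (volume.restrict J).map (graphMap p e γ) ≤ boundaryMeasure Ω := by
  have hmeas := h.continuous_graphMap.measurable
  refine Measure.le_iff.2 fun A hA => ?_
  rw [Measure.map_apply hmeas hA, Measure.restrict_apply (hmeas hA), Measure.restrict_apply hA,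
    ← hausdorffMeasure_real]
  have hπ : LipschitzWith 1 fun y : Plane => e (y - p) 0 := by
    refine LipschitzWith.of_dist_le_mul fun x y => ?_
    rw [Real.dist_eq, NNReal.coe_one, one_mul, dist_eq_norm]
    exact (abs_coord_le (e (x - p) - e (y - p)) 0).trans_eq
      (by rw [← map_sub, LinearIsometryEquiv.norm_map, sub_sub_sub_cancel_right])
  have hsub : graphMap p e γ ⁻¹' A ∩ J ⊆ (fun y : Plane => e (y - p) 0) '' (A ∩ frontier Ω) := by
    rintro s ⟨hsA, hsJ⟩
    exact ⟨graphMap p e γ s, ⟨hsA, hJ s hsJ⟩, frameMap_coord_zero p e _⟩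
  refine (measure_mono hsub).trans ?_
  simpa using hπ.hausdorffMeasure_image_le zero_le_one (A ∩ frontier Ω)

/-- The geometry of a graph chart: over a short parameter interval, the part of `Ω` near `p` and
the graph itself lie in a region to which `poincareLinked_frame` applies. -/
theorem exists_poincareLinked (h : IsGraphChart Ω p e γ K ρ) (hΩ : IsOpen Ω)
    (hp : p ∈ closure Ω) :
    ∃ a > 0, ∃ R : Set Plane, IsOpen R ∧ R.Nonempty ∧ R ⊆ Ω ∧ volume R ≠ ⊤ ∧
      PoincareLinked Ω (volume.restrict (Metric.ball p a ∩ Ω)) (volume.restrict R) ∧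
      (p ∈ frontier Ω → (∀ s ∈ Ioo (-a) a, graphMap p e γ s ∈ frontier Ω) ∧
        Metric.ball p a ∩ frontier Ω ⊆ graphMap p e γ '' Ioo (-a) a ∧
        PoincareLinked Ω ((volume.restrict (Ioo (-a) a)).map (graphMap p e γ))
          (volume.restrict R)) := by
  have hρ := h.pos
  -- The interval is so short that `γ` varies by at most `ρ / 4` over it.
  obtain ⟨a, ha, haρ, hKa⟩ : ∃ a > 0, a ≤ ρ / 4 ∧ K * a ≤ ρ / 4 := by
    refine ⟨ρ / 4 / (1 + K), by positivity, div_le_self (by positivity) (by simp), ?_⟩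
    rw [mul_div_assoc', div_le_iff₀ (by positivity)]
    nlinarith [K.coe_nonneg]
  have hosc : ∀ s ∈ Ioo (-a) a, |γ s - γ 0| ≤ ρ / 4 := fun s hs => by
    have h1 := h.lip.dist_le_mul s 0
    rw [Real.dist_eq, Real.dist_eq, sub_zero] at h1
    refine h1.trans ((mul_le_mul_of_nonneg_left (abs_lt.2 hs).le K.coe_nonneg).trans hKa)
  have h0 := h.apply_zero_le hp
  -- In a chart inside `Ω` the graph may lie outside the ball, so it is cut off from below.
  set g : ℝ → ℝ := fun s => max (γ s) (-(ρ / 4)) with hg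
  have hlow : ∀ s ∈ Ioo (-a) a, ρ / 2 - 3 * ρ / 4 ≤ g s := fun s _ =>
    le_trans (by linarith) (le_max_right _ _)
  have hup : ∀ s ∈ Ioo (-a) a, g s ≤ ρ / 2 - ρ / 4 := fun s hs =>
    max_le (by linarith [(abs_le.1 (hosc s hs)).2]) (by linarith)
  have hball : ∀ s ∈ Ioo (-a) a, ∀ t, -(ρ / 4) ≤ t → t < ρ / 2 →
      frameMap p e (s, t) ∈ Metric.ball p ρ := fun s hs t ht ht' => by
    rw [mem_ball_iff_norm]
    have h1 : |s| < a := abs_lt.2 hs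
    have h2 : |t| ≤ ρ / 2 := abs_le.2 ⟨by linarith, ht'.le⟩
    exact (norm_frameMap_sub_le p e (s, t)).trans_lt (by dsimp only; linarith)
  have hU : ∀ s ∈ Ioo (-a) a, ∀ t, g s < t → t < ρ / 2 → frameMap p e (s, t) ∈ Ω :=
    fun s hs t ht ht' => (h.frameMap_mem_iff (hball s hs t
      ((le_max_right _ _).trans ht.le) ht')).2 ((le_max_left _ _).trans_lt ht)
  set R₀ := Ioo (-a) a ×ˢ Ioo (ρ / 2 - ρ / 4) (ρ / 2)
  have hκ := measurableEmbedding_frameMap p e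
  have hmp := measurePreserving_frameMap p e
  have hRmap : (volume.restrict R₀).map (frameMap p e) =
      volume.restrict (frameMap p e '' R₀) := (hmp.restrict_image_emb hκ R₀).map_eq
  refine ⟨a, ha, frameMap p e '' R₀,
    (frameHomeomorph p e).isOpenMap _ (isOpen_Ioo.prod isOpen_Ioo), ?_, ?_, ?_, ?_, ?_⟩
  · exact Nonempty.image _ (Nonempty.prod ⟨0, by simpa using ha⟩
      (nonempty_Ioo.2 (by linarith)))
  · rintro _ ⟨⟨s, t⟩, ⟨hs, ht⟩, rfl⟩
    exact hU s hs t ((hup s hs).trans_lt ht.1) ht.2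
  · rw [← Measure.restrict_apply_univ, ← hRmap, Measure.map_apply hκ.measurable .univ,
      preimage_univ, Measure.restrict_apply_univ, Measure.volume_eq_prod, Measure.prod_prod]
    simp only [Real.volume_Ioo]
    finiteness
  · have hmap : (volume.restrict (frameMap p e ⁻¹' (Metric.ball p a ∩ Ω))).map (frameMap p e) =
        volume.restrict (Metric.ball p a ∩ Ω) := (hmp.restrict_preimage_emb hκ _).map_eq
    have hcoord : ∀ z ∈ frameMap p e ⁻¹' (Metric.ball p a ∩ Ω), |z.1| < a ∧ |z.2| < a ∧
        γ z.1 < z.2 := by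
      rintro z ⟨hz, hzΩ⟩
      have h1 := abs_coord_le (e (frameMap p e z - p)) 0
      have h2 := abs_coord_le (e (frameMap p e z - p)) 1
      rw [frameMap_coord_zero, LinearIsometryEquiv.norm_map] at h1
      rw [frameMap_coord_one, LinearIsometryEquiv.norm_map] at h2
      rw [mem_ball_iff_norm] at hz
      refine ⟨h1.trans_lt hz, h2.trans_lt hz, (h.frameMap_mem_iff ?_).1 hzΩ⟩
      rw [mem_ball_iff_norm]
      linarith
    have hms : MeasurableSet (frameMap p e ⁻¹' (Metric.ball p a ∩ Ω)) :=
      hκ.measurable (Metric.isOpen_ball.inter hΩ).measurableSet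
    have hstrip : ∀ A : Set ℝ, volume (Prod.fst ⁻¹' A ∩
        frameMap p e ⁻¹' (Metric.ball p a ∩ Ω)) ≤ volume A * ENNReal.ofReal (2 * a) := fun A => by
      calc _ ≤ volume (A ×ˢ Ioo (-a) a) := measure_mono fun z hz =>
            ⟨hz.1, abs_lt.1 (hcoord z hz.2).2.1⟩
        _ = _ := by
          rw [Measure.volume_eq_prod, Measure.prod_prod, Real.volume_Ioo]
          congr 2; ring
    have hfin : IsFiniteMeasure (volume.restrict (frameMap p e ⁻¹' (Metric.ball p a ∩ Ω))) := by
      refine ⟨?_⟩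
      rw [Measure.restrict_apply_univ]
      rw [hmp.measure_preimage_emb hκ]
      exact (measure_mono inter_subset_left).trans_lt Metric.isBounded_ball.measure_lt_top
    rw [← hmap, ← hRmap]
    refine poincareLinked_frame hΩ p e hlow hup hU _ ?_
      (B := ENNReal.ofReal (2 * a)) ENNReal.ofReal_ne_top ?_
    · filter_upwards [ae_restrict_mem hms] with z hz
      obtain ⟨h1, h2, h3⟩ := hcoord z hz
      have h2' := abs_lt.1 h2
      exact ⟨abs_lt.1 h1, max_le h3.le (by linarith), by linarith⟩
    · refine Measure.le_iff.2 fun A hA => ?_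
      rw [Measure.map_apply measurable_fst hA, Measure.restrict_apply (measurable_fst hA),
        Measure.smul_apply, smul_eq_mul, mul_comm]
      exact hstrip A
  · intro hpf
    have hγ0 : γ 0 = 0 := by
      refine le_antisymm h0 ?_
      have := mt (h.mem_iff p (Metric.mem_ball_self hρ)).2 (by
        rw [hΩ.frontier_eq] at hpf; exact hpf.2)
      simpa using this
    have hbd : ∀ s ∈ Ioo (-a) a, -(ρ / 4) ≤ γ s ∧ γ s ≤ ρ / 4 := fun s hs => by
      have := hosc s hs
      rwa [hγ0, sub_zero, abs_le] at this
    refine ⟨fun s hs => h.graphMap_mem_frontier hΩ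
      (hball s hs _ (hbd s hs).1 (by linarith [(hbd s hs).2])), ?_, ?_⟩
    · rintro y ⟨hy, hyf⟩
      refine ⟨e (y - p) 0, ?_, h.graphMap_coord_eq hΩ (Metric.ball_subset_ball (by linarith) hy)
        hyf⟩
      have := abs_coord_le (e (y - p)) 0
      rw [LinearIsometryEquiv.norm_map] at this
      rw [mem_ball_iff_norm] at hy
      exact abs_lt.1 (this.trans_lt hy)
    · have hcγ := h.lip.continuous
      have hgm : Measurable fun s => (s, γ s) := by fun_prop
      have hcomp : (volume.restrict (Ioo (-a) a)).map (graphMap p e γ) =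
          ((volume.restrict (Ioo (-a) a)).map fun s => (s, γ s)).map (frameMap p e) := by
        rw [Measure.map_map hκ.measurable hgm]
        rfl
      have := Measure.isFiniteMeasure_map (volume.restrict (Ioo (-a) a)) fun s => (s, γ s)
      rw [hcomp, ← hRmap]
      refine poincareLinked_frame hΩ p e hlow hup hU _ ?_ (B := 1) ENNReal.one_ne_top ?_
      · refine (ae_map_iff hgm.aemeasurable ?_).2 ?_
        rotate_left
        · filter_upwards [ae_restrict_mem measurableSet_Ioo] with s hs
          exact ⟨hs, max_le le_rfl (hbd s hs).1, by linarith [(hbd s hs).2]⟩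
        · refine (measurable_fst measurableSet_Ioo).inter (.inter ?_ ?_)
          · exact measurableSet_le (by fun_prop) measurable_snd
          · exact measurableSet_lt measurable_snd measurable_const
      · rw [Measure.map_map measurable_fst hgm, one_smul]
        exact (Measure.map_id (μ := volume.restrict (Ioo (-a) a))).le.trans
          Measure.restrict_le_self

end IsGraphChart

/-! ### The Poincaré inequality -/

/-- On a bounded connected Lipschitz domain Lebesgue measure is linked to itself, which is the
Poincaré–Wirtinger inequality for smooth functions. The local links are chained by connectedness,
and finitely many of them cover the closure. -/
theorem poincareLinked_self {Ω : Set Plane} (hΩ : IsOpen Ω) (hconn : IsConnected Ω)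
    (hbdd : Bornology.IsBounded Ω) (hlip : HasLipschitzBoundary Ω) :
    PoincareLinked Ω (volume.restrict Ω) (volume.restrict Ω) := by
  have hfin : ∀ S : Set Plane, IsFiniteMeasure (volume.restrict (S ∩ Ω)) := fun S =>
    ⟨by simpa using (measure_mono inter_subset_right).trans_lt hbdd.measure_lt_top⟩
  have hloc : ∀ x ∈ closure Ω, ∃ a > 0, PoincareLinked Ω
      (volume.restrict (Metric.ball x a ∩ Ω)) (volume.restrict (Metric.ball x a ∩ Ω)) := by
    intro x hx
    obtain ⟨e, γ, K, ρ, h⟩ := exists_isGraphChart hΩ hlip hx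
    obtain ⟨a, ha, R, hRo, hRne, -, hRfin, hl, -⟩ := h.exists_poincareLinked hΩ hx
    have : IsFiniteMeasure (volume.restrict R) := ⟨by simpa using hRfin.lt_top⟩
    refine ⟨a, ha, hl.trans ?_ hl.symm⟩
    simpa using hRo.measure_ne_zero volume hRne
  obtain ⟨x₀, hx₀⟩ := hconn.nonempty
  obtain ⟨a₀, ha₀, hl₀⟩ := hloc x₀ (subset_closure hx₀)
  set B := Metric.ball x₀ a₀ ∩ Ω with hB
  have hBne : volume.restrict B ≠ 0 := by
    simpa using (Metric.isOpen_ball.inter hΩ).measure_ne_zero volume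
      ⟨x₀, Metric.mem_ball_self ha₀, hx₀⟩
  -- A point is good when some neighbourhood of it in `Ω` is linked to the base ball.
  set good : Plane → Prop := fun x => ∃ N ∈ 𝓝 x,
    PoincareLinked Ω (volume.restrict (N ∩ Ω)) (volume.restrict B) with hgood
  have step : ∀ x a, PoincareLinked Ω (volume.restrict (Metric.ball x a ∩ Ω))
      (volume.restrict (Metric.ball x a ∩ Ω)) → 0 < a → ∀ z ∈ Metric.ball x a ∩ Ω, good z →
      good x := by
    rintro x a hl ha z ⟨hz, hzΩ⟩ ⟨N, hN, hNl⟩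
    refine ⟨Metric.ball x a, Metric.ball_mem_nhds x ha, ?_⟩
    have hM : N ∩ (Metric.ball x a ∩ Ω) ∈ 𝓝 z :=
      inter_mem hN (inter_mem (Metric.isOpen_ball.mem_nhds hz) (hΩ.mem_nhds hzΩ))
    have hf : IsFiniteMeasure (volume.restrict (N ∩ (Metric.ball x a ∩ Ω))) := by
      rw [← inter_assoc]; infer_instance
    have hs : N ∩ (Metric.ball x a ∩ Ω) ⊆ N ∩ Ω := fun y hy => ⟨hy.1, hy.2.2⟩
    refine (hl.mono le_rfl (Measure.restrict_mono inter_subset_right le_rfl)).trans ?_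
      (hNl.mono (Measure.restrict_mono hs le_rfl) le_rfl)
    simpa using (Measure.measure_pos_of_mem_nhds volume hM).ne'
  have hΩgood : Ω ⊆ {x | x ∈ Ω ∧ good x} := by
    refine hconn.isPreconnected.subset_left_of_subset_union (v := {x | x ∈ Ω ∧ ¬ good x})
      ?_ ?_ ?_ ?_ ?_
    · refine isOpen_iff_mem_nhds.2 ?_
      rintro x ⟨hx, N, hN, hl⟩
      filter_upwards [hΩ.mem_nhds hx, eventually_mem_nhds_iff.2 hN] with y hy hy'
      exact ⟨hy, N, hy', hl⟩
    · refine isOpen_iff_mem_nhds.2 ?_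
      rintro x ⟨hx, hxg⟩
      obtain ⟨a, ha, hl⟩ := hloc x (subset_closure hx)
      filter_upwards [hΩ.mem_nhds hx, Metric.ball_mem_nhds x ha] with y hy hy'
      exact ⟨hy, fun hg => hxg (step x a hl ha y ⟨hy', hy⟩ hg)⟩
    · exact disjoint_left.2 fun x hx hx' => hx'.2 hx.2
    · exact fun x hx => (em (good x)).imp (fun h => ⟨hx, h⟩) fun h => ⟨hx, h⟩
    · exact ⟨x₀, hx₀, hx₀, Metric.ball x₀ a₀, Metric.ball_mem_nhds x₀ ha₀, hl₀⟩
  have hcompact : IsCompact (closure Ω) := hbdd.isCompact_closure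
  have hmain : PoincareLinked Ω (volume.restrict (closure Ω ∩ Ω)) (volume.restrict B) := by
    refine hcompact.induction_on
      (p := fun S => PoincareLinked Ω (volume.restrict (S ∩ Ω)) (volume.restrict B))
      ?_ ?_ ?_ ?_
    · exact ⟨0, ENNReal.zero_ne_top, fun φ _ => by simp⟩
    · exact fun s t hst ht =>
        ht.mono (Measure.restrict_mono (inter_subset_inter_left _ hst) le_rfl) le_rfl
    · intro s t hs ht
      rw [union_inter_distrib_right]
      exact (hs.add ht).mono (Measure.restrict_union_le _ _) le_rfl
    · intro x hx
      obtain ⟨a, ha, hl⟩ := hloc x hx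
      obtain ⟨z, hz, hzΩ⟩ := mem_closure_iff_nhds.1 hx _ (Metric.ball_mem_nhds x ha)
      obtain ⟨N, hN, hNl⟩ := step x a hl ha z ⟨hz, hzΩ⟩ (hΩgood hzΩ).2
      exact ⟨N, mem_nhdsWithin_of_mem_nhds hN, hNl⟩
  rw [inter_eq_self_of_subset_right subset_closure] at hmain
  have : IsFiniteMeasure (volume.restrict Ω) := ⟨by simpa using hbdd.measure_lt_top⟩
  exact hmain.trans hBne hmain.symm

/-- A piece of boundary measure, parametrized by a graph chart, that charges the Dirichlet part and
is linked to the Lebesgue measure of the domain. -/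
theorem exists_boundary_poincareLinked {Ω Γ₀ : Set Plane} (hΩ : IsOpen Ω)
    (hconn : IsConnected Ω) (hbdd : Bornology.IsBounded Ω) (hlip : HasLipschitzBoundary Ω)
    (hsub : Γ₀ ⊆ frontier Ω) (hpos : 0 < μH[1] Γ₀) :
    ∃ μ : Measure Plane, IsFiniteMeasure μ ∧ μ ≤ boundaryMeasure Ω ∧ μ Γ₀ ≠ 0 ∧
      PoincareLinked Ω (volume.restrict Ω) μ := by
  obtain ⟨p, hp, hpm⟩ := exists_mem_forall_mem_nhdsWithin_pos_measure hpos.ne'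
  have hpf := hsub hp
  obtain ⟨e, γ, K, ρ, h⟩ := exists_isGraphChart hΩ hlip (frontier_subset_closure hpf)
  obtain ⟨a, ha, R, hRo, hRne, hRΩ, hRfin, -, hb⟩ :=
    h.exists_poincareLinked hΩ (frontier_subset_closure hpf)
  obtain ⟨hb1, hb2, hb3⟩ := hb hpf
  have hgm := h.continuous_graphMap.measurable
  have : IsFiniteMeasure (volume.restrict Ω) := ⟨by simpa using hbdd.measure_lt_top⟩
  have : IsFiniteMeasure (volume.restrict R) := ⟨by simpa using hRfin.lt_top⟩
  have : IsFiniteMeasure ((volume.restrict (Ioo (-a) a)).map (graphMap p e γ)) :=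
    Measure.isFiniteMeasure_map _ _
  refine ⟨(volume.restrict (Ioo (-a) a)).map (graphMap p e γ), inferInstance,
    h.map_graphMap_le hb1, fun h0 => ?_, ?_⟩
  · -- The graph map is Lipschitz, so a parameter null set gives a set of zero length.
    have h1 := le_antisymm ((Measure.le_map_apply hgm.aemeasurable Γ₀).trans h0.le) zero_le
    rw [Measure.restrict_apply' measurableSet_Ioo] at h1
    have h2 : Γ₀ ∩ Metric.ball p a ⊆ graphMap p e γ '' (graphMap p e γ ⁻¹' Γ₀ ∩ Ioo (-a) a) := by
      rintro y ⟨hy, hya⟩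
      obtain ⟨s, hs, rfl⟩ := hb2 ⟨hya, hsub hy⟩
      exact ⟨s, ⟨hy, hs⟩, rfl⟩
    have h3 := (lipschitzWith_graphMap p e h.lip).hausdorffMeasure_image_le zero_le_one
      (graphMap p e γ ⁻¹' Γ₀ ∩ Ioo (-a) a)
    rw [hausdorffMeasure_real, h1, mul_zero] at h3
    exact (hpm _ (inter_mem_nhdsWithin Γ₀ (Metric.ball_mem_nhds p ha))).ne'
      (le_antisymm ((measure_mono h2).trans h3) zero_le)
  · have hRne0 : volume.restrict R ≠ 0 := by simpa using hRo.measure_ne_zero volume hRne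
    exact ((poincareLinked_self hΩ hconn hbdd hlip).mono le_rfl
      (Measure.restrict_mono hRΩ le_rfl)).trans hRne0 hb3.symm

/-! ### Weak derivatives -/

/-- On a bounded open set weak partial derivatives in `L²` are unique. -/
theorem IsWeakPartial.unique {Ω : Set Plane} (hΩ : IsOpen Ω) (hbdd : Bornology.IsBounded Ω)
    {i : Fin 2} {v g g' : L2 Ω} (h : IsWeakPartial Ω i v g) (h' : IsWeakPartial Ω i v g') :
    g = g' := by
  have : IsFiniteMeasure (volume.restrict Ω) := ⟨by simpa using hbdd.measure_lt_top⟩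
  have hi : ∀ f : L2 Ω, Integrable f (volume.restrict Ω) := fun f =>
    (Lp.memLp f).integrable one_le_two
  have hsub : IntegrableOn (fun x => g x - g' x) Ω := (hi g).sub (hi g')
  have key := hΩ.ae_eq_zero_of_integral_contDiff_smul_eq_zero hsub.locallyIntegrableOn
    fun φ hφ hφc hφΩ => by
      have hφb : ∀ f : L2 Ω, Integrable (fun x => f x * φ x) (volume.restrict Ω) := fun f => by
        obtain ⟨C, hC⟩ := hφ.continuous.bounded_above_of_compact_support hφc
        exact (hi f).mul_bdd hφ.continuous.aestronglyMeasurable (ae_of_all _ hC)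
      rw [← setIntegral_eq_integral_of_forall_compl_eq_zero (s := Ω) fun x hx => by
        rw [image_eq_zero_of_notMem_tsupport fun hx' => hx (hφΩ hx'), zero_smul]]
      have e1 := h φ hφ hφc hφΩ
      rw [h' φ hφ hφc hφΩ, neg_inj] at e1
      simp only [smul_eq_mul, mul_comm (φ _), sub_mul]
      rw [integral_sub (hφb g) (hφb g'), e1, sub_self]
  refine Lp.ext ?_
  rw [EventuallyEq, ae_restrict_iff' hΩ.measurableSet]
  filter_upwards [key] with x hx hxΩ
  exact sub_eq_zero.1 (hx hxΩ)

theorem IsWeakGradient.unique {Ω : Set Plane} (hΩ : IsOpen Ω) (hbdd : Bornology.IsBounded Ω)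
    {v : L2 Ω} {G G' : Fin 2 → L2 Ω} (h : IsWeakGradient Ω v G) (h' : IsWeakGradient Ω v G') :
    G = G' :=
  funext fun i => (h i).unique hΩ hbdd (h' i)

theorem eLpNorm_two_sq {α : Type*} [MeasurableSpace α] (μ : Measure α) (f : α → ℝ) :
    eLpNorm f 2 μ ^ 2 = ∫⁻ x, ‖f x‖ₑ ^ 2 ∂μ := by
  simpa using eLpNorm_nnreal_pow_eq_lintegral (f := f) (μ := μ) (p := 2) two_ne_zero

theorem enorm_fderiv_sq_le (φ : Plane → ℝ) (x : Plane) :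
    ‖fderiv ℝ φ x‖ₑ ^ 2 ≤ ∑ i, ‖partialDeriv i φ x‖ₑ ^ 2 := by
  have h : ‖fderiv ℝ φ x‖ ≤ √(∑ i, partialDeriv i φ x ^ 2) := by
    refine ContinuousLinearMap.opNorm_le_bound _ (Real.sqrt_nonneg _) fun v => ?_
    have hv : v = ∑ i, v i • EuclideanSpace.single i (1 : ℝ) := by
      ext j; fin_cases j <;> simp
    have h1 : fderiv ℝ φ x v = ∑ i, v i * partialDeriv i φ x := by
      conv_lhs => rw [hv]
      simp [partialDeriv]
    rw [h1, EuclideanSpace.norm_eq, ← Real.sqrt_mul (by positivity)]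
    refine Real.abs_le_sqrt ?_
    rw [mul_comm (∑ i, _)]
    simpa using Finset.sum_mul_sq_le_sq_mul_sq Finset.univ v.ofLp (fun i => partialDeriv i φ x)
  simp only [enorm_sq_eq_ofReal]
  rw [← ENNReal.ofReal_sum_of_nonneg fun _ _ => sq_nonneg _, ← ofReal_norm,
    ← ENNReal.ofReal_pow (norm_nonneg _)]
  refine ENNReal.ofReal_le_ofReal ((pow_le_pow_left₀ (norm_nonneg _) h 2).trans_eq ?_)
  exact Real.sq_sqrt (by positivity)

/-- A function whose trace vanishes on `Γ₀` is estimated by its gradient as soon as some piece of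
boundary measure charging `Γ₀` is linked to the domain. -/
theorem measure_mul_enorm_sq_le {Ω Γ₀ : Set Plane} (hΩ : IsOpen Ω)
    (hbdd : Bornology.IsBounded Ω) {μ : Measure Plane} [IsFiniteMeasure μ]
    (hμ : μ ≤ boundaryMeasure Ω) {C : ℝ≥0∞} (hC : C ≠ ⊤)
    (hl : ∀ φ : Plane → ℝ, ContDiff ℝ ∞ φ →
      ∫⁻ x in Ω, ∫⁻ y, ‖φ x - φ y‖ₑ ^ 2 ∂μ ≤ C * ∫⁻ x in Ω, ‖fderiv ℝ φ x‖ₑ ^ 2)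
    {v : L2 Ω} (hv : v ∈ sobolevH1Dirichlet Ω Γ₀) {G : Fin 2 → L2 Ω}
    (hG : IsWeakGradient Ω v G) :
    μ Γ₀ * ‖v‖ₑ ^ 2 ≤ 4 * C * ∑ i, ‖G i‖ₑ ^ 2 := by
  have hΩfin : volume Ω ≠ ⊤ := hbdd.measure_lt_top.ne
  obtain ⟨-, g, ⟨G', φ, hG', hφ, h₀, h₁, h₂⟩, hg⟩ := hv
  obtain rfl := hG'.unique hΩ hbdd hG
  -- The set `Γ₀` need not be measurable; it is replaced by the zero set of the trace.
  set Z : Set Plane := {x | g x = 0} with hZ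
  have hgm : Measurable g := (Lp.stronglyMeasurable g).measurable
  have hvm : Measurable v := (Lp.stronglyMeasurable v).measurable
  have hZm : MeasurableSet Z := hgm (measurableSet_singleton 0)
  have hΓZ : μ Γ₀ ≤ μ Z := measure_mono_ae ((Measure.absolutelyContinuous_of_le hμ).ae_le hg)
  have hvn : ‖v‖ₑ = eLpNorm v 2 (volume.restrict Ω) := Lp.enorm_def v
  have bound : ∀ n, μ Γ₀ * ‖v‖ₑ ^ 2 ≤
      2 * (μ univ * eLpNorm (fun x => φ n x - v x) 2 (volume.restrict Ω) ^ 2 +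
        2 * (C * ∑ i, (eLpNorm (fun x => partialDeriv i (φ n) x - G' i x) 2 (volume.restrict Ω) +
          ‖G' i‖ₑ) ^ 2 +
        volume Ω * eLpNorm (fun x => φ n x - g x) 2 (boundaryMeasure Ω) ^ 2)) := by
    intro n
    have hc := (hφ n).continuous
    have hcf : Continuous (fderiv ℝ (φ n)) := (hφ n).continuous_fderiv (by simp)
    have hgrad : ∫⁻ x in Ω, ‖fderiv ℝ (φ n) x‖ₑ ^ 2 ≤
        ∑ i, (eLpNorm (fun x => partialDeriv i (φ n) x - G' i x) 2 (volume.restrict Ω) +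
          ‖G' i‖ₑ) ^ 2 := by
      have hm : ∀ i, Measurable (partialDeriv i (φ n)) := fun i =>
        (hcf.clm_apply continuous_const).measurable
      calc _ ≤ ∫⁻ x in Ω, ∑ i, ‖partialDeriv i (φ n) x‖ₑ ^ 2 :=
            lintegral_mono fun x => enorm_fderiv_sq_le _ _
        _ = ∑ i, eLpNorm (partialDeriv i (φ n)) 2 (volume.restrict Ω) ^ 2 := by
            rw [lintegral_finsetSum _ fun i _ => by have := hm i; fun_prop]
            simp_rw [eLpNorm_two_sq]
        _ ≤ _ := by
            refine Finset.sum_le_sum fun i _ => ?_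
            gcongr
            rw [Lp.enorm_def]
            have := eLpNorm_add_le (f := fun x => partialDeriv i (φ n) x - G' i x) (g := G' i)
              ((hm i).aestronglyMeasurable.sub (Lp.aestronglyMeasurable (G' i)))
              (Lp.aestronglyMeasurable (G' i)) one_le_two
            simpa [Pi.add_def] using this
    have hbd : ∫⁻ y, ‖φ n y - g y‖ₑ ^ 2 ∂μ ≤
        eLpNorm (fun x => φ n x - g x) 2 (boundaryMeasure Ω) ^ 2 := by
      rw [eLpNorm_two_sq]
      exact lintegral_mono' hμ le_rfl
    calc μ Γ₀ * ‖v‖ₑ ^ 2 ≤ μ Z * ∫⁻ x in Ω, ‖v x‖ₑ ^ 2 := by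
          rw [hvn, eLpNorm_two_sq]; gcongr
      _ = ∫⁻ x in Ω, ∫⁻ y in Z, ‖v x - g y‖ₑ ^ 2 ∂μ := by
          rw [mul_comm, ← lintegral_mul_const _ (by fun_prop)]
          refine lintegral_congr fun x => ?_
          rw [setLIntegral_congr_fun hZm (g := fun _ => ‖v x‖ₑ ^ 2) fun y hy => by
            simp only [hZ, mem_ofPred_eq] at hy; simp [hy]]
          simp
      _ ≤ ∫⁻ x in Ω, ∫⁻ y, 2 * (‖φ n x - v x‖ₑ ^ 2 + 2 * (‖φ n x - φ n y‖ₑ ^ 2 +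
            ‖φ n y - g y‖ₑ ^ 2)) ∂μ := by
          refine lintegral_mono fun x => (setLIntegral_le_lintegral _ _).trans
            (lintegral_mono fun y => ?_)
          grw [enorm_sub_sq_le (v x) (φ n x) (g y), enorm_sub_sq_le (φ n x) (φ n y) (g y),
            ← enorm_neg (v x - φ n x), neg_sub]
      _ = 2 * (μ univ * (∫⁻ x in Ω, ‖φ n x - v x‖ₑ ^ 2) +
            2 * ((∫⁻ x in Ω, ∫⁻ y, ‖φ n x - φ n y‖ₑ ^ 2 ∂μ) +
              volume Ω * ∫⁻ y, ‖φ n y - g y‖ₑ ^ 2 ∂μ)) := by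
          have m1 : Measurable fun x => ∫⁻ y, ‖φ n x - φ n y‖ₑ ^ 2 ∂μ :=
            Measurable.lintegral_prod_right'
              (f := fun p : Plane × Plane => ‖φ n p.1 - φ n p.2‖ₑ ^ 2) (by fun_prop)
          have : ∀ x, ∫⁻ y, 2 * (‖φ n x - v x‖ₑ ^ 2 + 2 * (‖φ n x - φ n y‖ₑ ^ 2 +
              ‖φ n y - g y‖ₑ ^ 2)) ∂μ = 2 * (μ univ * ‖φ n x - v x‖ₑ ^ 2 +
                2 * (∫⁻ y, ‖φ n x - φ n y‖ₑ ^ 2 ∂μ + ∫⁻ y, ‖φ n y - g y‖ₑ ^ 2 ∂μ)) := by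
            intro x
            rw [lintegral_const_mul _ (by fun_prop), lintegral_add_left (by fun_prop),
              lintegral_const, lintegral_const_mul _ (by fun_prop),
              lintegral_add_left (by fun_prop), mul_comm (μ univ)]
          simp_rw [this]
          rw [lintegral_const_mul _ (by fun_prop), lintegral_add_left (by fun_prop),
            lintegral_const_mul _ (by fun_prop), lintegral_const_mul _ (by fun_prop),
            lintegral_add_left (by fun_prop), lintegral_const, Measure.restrict_apply_univ,
            mul_comm (volume Ω)]
      _ ≤ _ := by
          grw [hl _ (hφ n), hgrad, hbd, ← eLpNorm_two_sq]
  have lim : Tendsto (fun n =>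
      2 * (μ univ * eLpNorm (fun x => φ n x - v x) 2 (volume.restrict Ω) ^ 2 +
        2 * (C * ∑ i, (eLpNorm (fun x => partialDeriv i (φ n) x - G' i x) 2 (volume.restrict Ω) +
          ‖G' i‖ₑ) ^ 2 +
        volume Ω * eLpNorm (fun x => φ n x - g x) 2 (boundaryMeasure Ω) ^ 2))) atTop
      (𝓝 (2 * (μ univ * 0 ^ 2 + 2 * (C * ∑ i, (0 + ‖G' i‖ₑ) ^ 2 + volume Ω * 0 ^ 2)))) := by
    have tsq : ∀ {u : ℕ → ℝ≥0∞} {l : ℝ≥0∞}, Tendsto u atTop (𝓝 l) →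
        Tendsto (fun n => u n ^ 2) atTop (𝓝 (l ^ 2)) := fun h => ENNReal.Tendsto.pow h
    refine ENNReal.Tendsto.const_mul (.add ?_ ?_) (.inr (by simp))
    · exact ENNReal.Tendsto.const_mul (tsq h₀) (.inr (measure_ne_top μ univ))
    refine ENNReal.Tendsto.const_mul (.add ?_ ?_) (.inr (by simp))
    · refine ENNReal.Tendsto.const_mul (tendsto_finsetSum _ fun i _ => tsq ?_) (.inr hC)
      exact (h₁ i).add tendsto_const_nhds
    · exact ENNReal.Tendsto.const_mul (tsq h₂) (.inr hΩfin)
  refine (ge_of_tendsto' lim bound).trans_eq ?_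
  simp only [zero_add, ne_eq, OfNat.ofNat_ne_zero, not_false_eq_true, zero_pow, mul_zero, add_zero]
  ring

theorem exists_isPoincareConstant {Ω Γ₀ : Set Plane} (hΩ : IsOpen Ω)
    (hconn : IsConnected Ω) (hbdd : Bornology.IsBounded Ω) (hlip : HasLipschitzBoundary Ω)
    (hsub : Γ₀ ⊆ frontier Ω) (hpos : 0 < μH[1] Γ₀) : ∃ c, IsPoincareConstant Ω Γ₀ c := by
  obtain ⟨μ, hμfin, hμ, hμ0, C, hC, hl⟩ :=
    exists_boundary_poincareLinked hΩ hconn hbdd hlip hsub hpos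
  set k := (μ Γ₀).toReal
  set D := (4 * C).toReal
  have hk : 0 < k := ENNReal.toReal_pos hμ0 (measure_ne_top μ Γ₀)
  have hD : 0 ≤ D := ENNReal.toReal_nonneg
  refine ⟨k / (D + 1), by positivity, fun v hv G hG => ?_⟩
  have h1 := measure_mul_enorm_sq_le hΩ hbdd hμ hC hl hv hG
  have h2 : k * ‖v‖ ^ 2 ≤ D * ∑ i, ‖G i‖ ^ 2 := by
    have hfin : ∀ i ∈ Finset.univ, ‖G i‖ₑ ^ 2 ≠ ⊤ := fun i _ => by finiteness
    have h3 := ENNReal.toReal_mono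
      (ENNReal.mul_ne_top (by finiteness) (ENNReal.sum_ne_top.2 hfin)) h1
    rw [ENNReal.toReal_mul, ENNReal.toReal_mul, ENNReal.toReal_sum hfin] at h3
    simpa only [ENNReal.toReal_pow, toReal_enorm] using h3
  rw [div_mul_eq_mul_div, div_le_iff₀ (by positivity)]
  have : 0 ≤ ∑ i, ‖G i‖ ^ 2 := by positivity
  linarith

/-! ### The divergence theorem in a graph chart -/

/-- The shear of the plane carrying the half-plane to the epigraph of `γ`. -/
def shearHomeomorph (γ : ℝ → ℝ) (hγ : Continuous γ) : ℝ × ℝ ≃ₜ ℝ × ℝ where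
  toFun z := (z.1, γ z.1 + z.2)
  invFun z := (z.1, z.2 - γ z.1)
  left_inv z := by simp
  right_inv z := by simp
  continuous_toFun := by fun_prop
  continuous_invFun := by fun_prop

theorem measurePreserving_shear {γ : ℝ → ℝ} (hγ : Continuous γ) :
    MeasurePreserving (fun z : ℝ × ℝ => (z.1, γ z.1 + z.2)) :=
  (MeasurePreserving.id volume).skew_product (g := fun s t => γ s + t) (by fun_prop)
    (ae_of_all _ fun s => (measurePreserving_add_left volume (γ s)).map_eq)

/-- An integral over the epigraph of `γ`, flattened to the half-plane by the shear. -/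
theorem setIntegral_epigraph_eq {γ : ℝ → ℝ} (hγ : Continuous γ) (g : ℝ × ℝ → ℝ) :
    ∫ z in {z : ℝ × ℝ | γ z.1 < z.2}, g z =
      ∫ z, g (z.1, γ z.1 + z.2) ∂(volume.prod (volume.restrict (Ioi (0 : ℝ)))) := by
  have h := (measurePreserving_shear hγ).setIntegral_preimage_emb
    (shearHomeomorph γ hγ).measurableEmbedding g {z : ℝ × ℝ | γ z.1 < z.2}
  rw [← h]
  have hset : (fun z : ℝ × ℝ => (z.1, γ z.1 + z.2)) ⁻¹' {z : ℝ × ℝ | γ z.1 < z.2} =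
      univ ×ˢ Ioi 0 := by
    ext z; simp
  rw [hset, Measure.volume_eq_prod, ← Measure.prod_restrict, Measure.restrict_univ]

theorem integral_eq_zero_of_lipschitz_of_ae_hasDerivAt {g g' : ℝ → ℝ} {C : ℝ≥0}
    (hg : LipschitzWith C g) (hgc : HasCompactSupport g) (h : ∀ᵐ s, HasDerivAt g (g' s) s) :
    ∫ s, g' s = 0 := by
  have hone : LipschitzWith 0 fun _ : ℝ => (1 : ℝ) := LipschitzWith.const 1
  have key := hone.integral_lineDeriv_mul_eq (μ := volume) hg hgc (-1)
  have h0 : ∀ s : ℝ, lineDeriv ℝ (fun _ : ℝ => (1 : ℝ)) s (-1) = 0 := fun s => by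
    simp [lineDeriv]
  simp only [h0, zero_mul, integral_zero, neg_neg, mul_one] at key
  rw [key]
  refine integral_congr_ae (h.mono fun s hs => ?_)
  have := (hs.hasFDerivAt.hasLineDerivAt 1).lineDeriv
  simpa using this.symm

section Epigraph

variable {F : ℝ × ℝ → ℝ} {γ : ℝ → ℝ} {K : ℝ≥0}

theorem hasCompactSupport_comp_shear {F : ℝ × ℝ → ℝ} (hF : HasCompactSupport F)
    (hγ : Continuous γ) : HasCompactSupport fun z : ℝ × ℝ => F (z.1, γ z.1 + z.2) :=
  hF.comp_homeomorph (shearHomeomorph γ hγ)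

theorem integral_Ioi_fderiv_shear (hF : ContDiff ℝ 1 F) (hFc : HasCompactSupport F)
    (s : ℝ) : ∫ t in Ioi (0 : ℝ), fderiv ℝ F (s, γ s + t) (0, 1) = -F (s, γ s) := by
  have hd : ∀ t, HasDerivAt (fun t => F (s, γ s + t)) (fderiv ℝ F (s, γ s + t) (0, 1)) t :=
    fun t => (hF.differentiable (by simp) _).hasFDerivAt.comp_hasDerivAt t
      ((hasDerivAt_const t s).prodMk ((hasDerivAt_id t).const_add (γ s)))
  have hcs : HasCompactSupport fun t => F (s, γ s + t) := by
    refine hFc.comp_isClosedEmbedding (g := fun t => (s, γ s + t)) ?_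
    exact (Topology.IsClosedEmbedding.of_isEmbedding_isClosedMap
      (isEmbedding_prodMkRight s) (isClosedMap_prodMk_left s)).comp
      (Homeomorph.addLeft (γ s)).isClosedEmbedding
  have := hcs.integral_Ioi_deriv_eq (hF.comp (by fun_prop)) 0
  rw [show (F ∘ fun t => (s, γ s + t)) = fun t => F (s, γ s + t) from rfl,
    funext fun t => (hd t).deriv] at this
  simpa using this

theorem hasCompactSupport_comp_graph (hF : HasCompactSupport F) (hγ : Continuous γ) (t : ℝ) :
    HasCompactSupport fun s => F (s, γ s + t) :=
  (hasCompactSupport_comp_shear hF hγ).comp_isClosedEmbedding (g := fun s => (s, t))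
    (Topology.IsClosedEmbedding.of_isEmbedding_isClosedMap
      (isEmbedding_prodMkLeft t) (isClosedMap_prodMk_right t))

theorem integral_fderiv_shear (hF : ContDiff ℝ 1 F) (hFc : HasCompactSupport F)
    (hγ : LipschitzWith K γ) (t : ℝ) :
    ∫ s, fderiv ℝ F (s, γ s + t) (1, 0) =
      -∫ s, deriv γ s * fderiv ℝ F (s, γ s + t) (0, 1) := by
  have hcF : Continuous (fderiv ℝ F) := hF.continuous_fderiv (by simp)
  have hγc := hγ.continuous
  obtain ⟨C, hC⟩ := hF.lipschitzWith_of_hasCompactSupport hFc (by simp)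
  have hlip := hC.comp (LipschitzWith.id.prodMk (hγ.add (LipschitzWith.const t)))
  have hint : ∀ v, Integrable fun s => fderiv ℝ F (s, γ s + t) v := fun v =>
    (by fun_prop : Continuous fun s => fderiv ℝ F (s, γ s + t) v).integrable_of_hasCompactSupport
      (hasCompactSupport_comp_graph (hFc.fderiv_apply (𝕜 := ℝ) v) hγc t)
  have hint' : Integrable fun s => deriv γ s * fderiv ℝ F (s, γ s + t) (0, 1) :=
    (hint _).bdd_mul (measurable_deriv γ).aestronglyMeasurable
      (ae_of_all _ fun s => norm_deriv_le_of_lipschitz hγ)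
  have key := integral_eq_zero_of_lipschitz_of_ae_hasDerivAt hlip
    (hasCompactSupport_comp_graph hFc hγc t)
    (g' := fun s => fderiv ℝ F (s, γ s + t) (1, 0) +
      deriv γ s * fderiv ℝ F (s, γ s + t) (0, 1)) <| by
    filter_upwards [hγ.ae_differentiableAt_real] with s hs
    have h1 := (hF.differentiable (by simp) (s, γ s + t)).hasFDerivAt.comp_hasDerivAt s
      ((hasDerivAt_id s).prodMk (hs.hasDerivAt.add_const t))
    refine h1.congr_deriv ?_
    rw [← smul_eq_mul, ← map_smul, ← map_add]
    simp
  rw [integral_add (hint _) hint'] at key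
  linarith

theorem integrable_shear {G : ℝ × ℝ → ℝ} (hG : Continuous G) (hGc : HasCompactSupport G)
    (hγ : Continuous γ) : Integrable (fun z : ℝ × ℝ => G (z.1, γ z.1 + z.2))
      (volume.prod (volume.restrict (Ioi (0 : ℝ)))) :=
  (by fun_prop : Continuous fun z : ℝ × ℝ => G (z.1, γ z.1 + z.2)).integrable_of_hasCompactSupport
    (hasCompactSupport_comp_shear hGc hγ)

theorem setIntegral_epigraph_fderiv_snd (hF : ContDiff ℝ 1 F) (hFc : HasCompactSupport F)
    (hγ : Continuous γ) :
    ∫ z in {z : ℝ × ℝ | γ z.1 < z.2}, fderiv ℝ F z (0, 1) = -∫ s, F (s, γ s) := by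
  have hcF : Continuous (fderiv ℝ F) := hF.continuous_fderiv (by simp)
  have hint := integrable_shear (G := fun z => fderiv ℝ F z (0, 1)) (by fun_prop)
    (hFc.fderiv_apply (𝕜 := ℝ) _) hγ
  rw [setIntegral_epigraph_eq hγ, integral_prod _ hint, ← integral_neg]
  exact integral_congr_ae (ae_of_all _ fun s => integral_Ioi_fderiv_shear hF hFc s)

/-- Each translate of the graph contributes zero to the integral of the derivative along it, which
trades the horizontal derivative for the vertical one. -/
theorem setIntegral_epigraph_fderiv_fst (hF : ContDiff ℝ 1 F) (hFc : HasCompactSupport F)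
    (hγ : LipschitzWith K γ) :
    ∫ z in {z : ℝ × ℝ | γ z.1 < z.2}, fderiv ℝ F z (1, 0) = ∫ s, deriv γ s * F (s, γ s) := by
  have hcF : Continuous (fderiv ℝ F) := hF.continuous_fderiv (by simp)
  have hγc := hγ.continuous
  have hint : ∀ v, Integrable (fun z : ℝ × ℝ => fderiv ℝ F (z.1, γ z.1 + z.2) v)
      (volume.prod (volume.restrict (Ioi (0 : ℝ)))) := fun v =>
    integrable_shear (G := fun z => fderiv ℝ F z v) (by fun_prop)
      (hFc.fderiv_apply (𝕜 := ℝ) _) hγc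
  have hint' : Integrable (fun z : ℝ × ℝ => deriv γ z.1 * fderiv ℝ F (z.1, γ z.1 + z.2) (0, 1))
      (volume.prod (volume.restrict (Ioi (0 : ℝ)))) :=
    (hint _).bdd_mul ((measurable_deriv γ).comp measurable_fst).aestronglyMeasurable
      (ae_of_all _ fun z => norm_deriv_le_of_lipschitz hγ)
  rw [setIntegral_epigraph_eq hγc, integral_prod_symm _ (hint _)]
  simp_rw [integral_fderiv_shear hF hFc hγ]
  rw [integral_neg, ← integral_prod_symm _ hint', integral_prod _ hint', ← integral_neg]
  refine integral_congr_ae (ae_of_all _ fun s => ?_)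
  simp only
  rw [integral_const_mul, integral_Ioi_fderiv_shear hF hFc, mul_neg, neg_neg]

end Epigraph

/-- The outward normal `(γ', -1)` of the epigraph of `γ` in a frame, not normalized. -/
noncomputable def graphNormal (e : Plane ≃ₗᵢ[ℝ] Plane) (γ : ℝ → ℝ) (s : ℝ) : Plane :=
  e.symm !₂[deriv γ s, -1]

/-- The divergence theorem for a function supported in the ball of a graph chart, with the boundary
term written in the parameter of the graph. -/
theorem IsGraphChart.setIntegral_partialDeriv {Ω : Set Plane} {p : Plane}
    {e : Plane ≃ₗᵢ[ℝ] Plane} {γ : ℝ → ℝ} {K : ℝ≥0} {ρ : ℝ} (h : IsGraphChart Ω p e γ K ρ)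
    {f : Plane → ℝ} (hf : ContDiff ℝ 1 f)
    (hΩ : IsOpen Ω)
    (hfs : tsupport f ⊆ Metric.ball p ρ) (i : Fin 2) :
    ∫ x in Ω, partialDeriv i f x = ∫ s, f (graphMap p e γ s) * graphNormal e γ s i := by
  have hfc : HasCompactSupport f :=
    Metric.isCompact_of_isClosed_isBounded (isClosed_tsupport f) (Metric.isBounded_ball.subset hfs)
  have hmp := measurePreserving_frameMap p e
  have hκ := measurableEmbedding_frameMap p e
  have hγc := h.lip.continuous
  set L : ℝ × ℝ →L[ℝ] Plane := (e.symm.toContinuousLinearEquiv : Plane →L[ℝ] Plane) ∘L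
    (EuclideanSpace.equiv (Fin 2) ℝ).symm.toContinuousLinearMap ∘L
    (ContinuousLinearEquiv.finTwoArrow ℝ ℝ).symm.toContinuousLinearMap with hL
  have hLa : ∀ z : ℝ × ℝ, L z = e.symm !₂[z.1, z.2] := fun z => rfl
  have hFL : frameMap p e = fun z => p + L z := by ext1 z; rw [frameMap, hLa]
  have hFd : ∀ z, HasFDerivAt (frameMap p e) L z := fun z => by
    rw [hFL]
    exact L.hasFDerivAt.const_add p
  set F : ℝ × ℝ → ℝ := fun z => f (frameMap p e z) with hF
  have hFsm : ContDiff ℝ 1 F := by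
    rw [hF, hFL]
    fun_prop
  have hFc : HasCompactSupport F := hfc.comp_homeomorph (frameHomeomorph p e)
  have hFder : ∀ z v, fderiv ℝ F z v = fderiv ℝ f (frameMap p e z) (L v) := fun z v => by
    have := ((hf.differentiable (by simp) (frameMap p e z)).hasFDerivAt.comp z (hFd z)).fderiv
    rw [show F = f ∘ frameMap p e from rfl, this]
    rfl
  have hloc : ∀ v : Plane, ∫ x in Ω, fderiv ℝ f x v =
      ∫ z in {z : ℝ × ℝ | γ z.1 < z.2}, fderiv ℝ f (frameMap p e z) v := fun v => by
    rw [← hmp.setIntegral_preimage_emb hκ (fun x => fderiv ℝ f x v) Ω,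
      ← integral_indicator (hκ.measurable hΩ.measurableSet),
      ← integral_indicator (measurableSet_lt (by fun_prop) measurable_snd)]
    congr 1 with z
    by_cases hz : frameMap p e z ∈ Metric.ball p ρ
    · have hiff : z ∈ frameMap p e ⁻¹' Ω ↔ z ∈ {z : ℝ × ℝ | γ z.1 < z.2} := h.frameMap_mem_iff hz
      by_cases hγz : z ∈ {z : ℝ × ℝ | γ z.1 < z.2}
      · rw [indicator_of_mem hγz, indicator_of_mem (hiff.2 hγz)]
      · rw [indicator_of_notMem hγz, indicator_of_notMem (mt hiff.1 hγz)]
    · have : fderiv ℝ f (frameMap p e z) = 0 :=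
        fderiv_of_notMem_tsupport ℝ fun hz' => hz (hfs hz')
      rw [indicator_apply_eq_zero.2 fun _ => by rw [this]; rfl,
        indicator_apply_eq_zero.2 fun _ => by rw [this]; rfl]
  set w : Plane := e (EuclideanSpace.single i 1) with hw
  have hsplit : ∀ z : ℝ × ℝ, fderiv ℝ f (frameMap p e z) (EuclideanSpace.single i 1) =
      w 0 * fderiv ℝ F z (1, 0) + w 1 * fderiv ℝ F z (0, 1) := fun z => by
    have h1 : EuclideanSpace.single i (1 : ℝ) = L (w 0, w 1) := by
      rw [hLa, LinearIsometryEquiv.eq_symm_apply]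
      ext j; fin_cases j <;> rfl
    rw [h1, ← hFder, ← smul_eq_mul, ← smul_eq_mul, ← map_smul, ← map_smul, ← map_add]
    simp
  have hcF : Continuous (fderiv ℝ F) := hFsm.continuous_fderiv (by simp)
  have hint : ∀ v, IntegrableOn (fun z => fderiv ℝ F z v) {z : ℝ × ℝ | γ z.1 < z.2} := fun v =>
    ((by fun_prop : Continuous fun z => fderiv ℝ F z v).integrable_of_hasCompactSupport
      (hFc.fderiv_apply (𝕜 := ℝ) v)).integrableOn
  have hFg : Integrable fun s => F (s, γ s) := by
    have := hasCompactSupport_comp_graph hFc hγc 0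
    simp only [add_zero] at this
    exact (hFsm.continuous.comp (by fun_prop)).integrable_of_hasCompactSupport this
  have hFg' : Integrable fun s => deriv γ s * F (s, γ s) :=
    hFg.bdd_mul (measurable_deriv γ).aestronglyMeasurable
      (ae_of_all _ fun s => norm_deriv_le_of_lipschitz h.lip)
  have hn : ∀ s, graphNormal e γ s i = deriv γ s * w 0 - w 1 := fun s => by
    have h1 : graphNormal e γ s i =
        inner ℝ (EuclideanSpace.single i (1 : ℝ)) (graphNormal e γ s) := by
      simp [EuclideanSpace.inner_single_left]
    rw [h1, ← e.inner_map_map, graphNormal, LinearIsometryEquiv.apply_symm_apply]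
    simp [PiLp.inner_apply, hw]
    ring
  calc ∫ x in Ω, partialDeriv i f x
      = w 0 * (∫ z in {z : ℝ × ℝ | γ z.1 < z.2}, fderiv ℝ F z (1, 0)) +
          w 1 * ∫ z in {z : ℝ × ℝ | γ z.1 < z.2}, fderiv ℝ F z (0, 1) := by
        rw [← integral_const_mul, ← integral_const_mul,
          ← integral_add ((hint _).const_mul _) ((hint _).const_mul _)]
        simp_rw [partialDeriv, hloc, hsplit]
    _ = w 0 * (∫ s, deriv γ s * F (s, γ s)) + w 1 * -∫ s, F (s, γ s) := by
        rw [setIntegral_epigraph_fderiv_fst hFsm hFc h.lip,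
          setIntegral_epigraph_fderiv_snd hFsm hFc hγc]
    _ = ∫ s, (w 0 * (deriv γ s * F (s, γ s)) - w 1 * F (s, γ s)) := by
        rw [integral_sub (hFg'.const_mul _) (hFg.const_mul _), integral_const_mul,
          integral_const_mul]
        ring
    _ = _ := by
        refine integral_congr_ae (ae_of_all _ fun s => ?_)
        simp only [hn, graphMap, hF]
        ring

/-- Where the graph function is differentiable, the vector `(γ', -1)` is normal to the boundary. -/
theorem IsGraphChart.isOutwardNormal {Ω : Set Plane} {p : Plane}
    {e : Plane ≃ₗᵢ[ℝ] Plane} {γ : ℝ → ℝ} {K : ℝ≥0} {ρ : ℝ} (h : IsGraphChart Ω p e γ K ρ)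
    {s : ℝ} (hs : graphMap p e γ s ∈ Metric.ball p ρ) (hd : DifferentiableAt ℝ γ s) :
    1 ≤ ‖graphNormal e γ s‖ ∧
    IsOutwardNormal Ω (graphMap p e γ s) (‖graphNormal e γ s‖⁻¹ • graphNormal e γ s) := by
  set n := graphNormal e γ s with hn
  set x := graphMap p e γ s with hx
  have hn1 : 1 ≤ ‖n‖ := by
    have := abs_coord_le (e n) 1
    rw [hn, graphNormal, LinearIsometryEquiv.apply_symm_apply] at this
    simpa [hn, graphNormal] using this
  have hnpos : 0 < ‖n‖ := one_pos.trans_le hn1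
  refine ⟨hn1, ?_, fun ε hε => ?_⟩
  · rw [norm_smul, norm_inv, norm_norm, inv_mul_cancel₀ hnpos.ne']
  have hdiff : ∀ᶠ s' in 𝓝 s, |γ s' - γ s - (s' - s) * deriv γ s| ≤ ε * |s' - s| := by
    simpa using hd.hasDerivAt.isLittleO.def hε
  have hx0 : e (x - p) 0 = s := frameMap_coord_zero p e _
  have hx1 : e (x - p) 1 = γ s := frameMap_coord_one p e _
  have htend : Tendsto (fun y => e (y - p) 0) (𝓝 x) (𝓝 s) := by
    have := (continuous_coord p e 0).continuousAt (x := x)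
    rwa [ContinuousAt, hx0] at this
  filter_upwards [htend.eventually hdiff, Metric.isOpen_ball.mem_nhds hs] with y hy hyb
  have hc0 : e (y - x) 0 = e (y - p) 0 - s := by
    rw [← sub_sub_sub_cancel_right y x p, map_sub, PiLp.sub_apply, hx0]
  have hc1 : e (y - x) 1 = e (y - p) 1 - γ s := by
    rw [← sub_sub_sub_cancel_right y x p, map_sub, PiLp.sub_apply, hx1]
  have hinner : inner ℝ (y - x) (‖n‖⁻¹ • n) =
      ‖n‖⁻¹ * ((e (y - p) 0 - s) * deriv γ s - (e (y - p) 1 - γ s)) := by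
    rw [inner_smul_right, ← e.inner_map_map, hn, graphNormal,
      LinearIsometryEquiv.apply_symm_apply, ← hc0, ← hc1]
    simp [PiLp.inner_apply, -map_sub]
    ring_nf
  have hle : |e (y - p) 0 - s| ≤ ‖n‖ * ‖y - x‖ := by
    have := abs_coord_le (e (y - x)) 0
    rw [LinearIsometryEquiv.norm_map, hc0] at this
    exact this.trans (le_mul_of_one_le_left (norm_nonneg _) hn1)
  have hle' : ε * |e (y - p) 0 - s| ≤ ‖n‖ * (ε * ‖y - x‖) := by
    nlinarith [mul_le_mul_of_nonneg_left hle hε.le]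
  have hab := abs_le.1 hy
  rw [hinner, h.mem_iff y hyb]
  constructor
  · intro hlt
    rw [inv_mul_eq_div, lt_div_iff₀' hnpos] at hlt
    linarith
  · intro hlt
    rw [inv_mul_eq_div, div_lt_iff₀' hnpos] at hlt
    linarith

/-! ### Green's formula on the domain of the Laplacian -/

/-- Products of two sequences converging in `L²` may be integrated against a bounded weight in the
limit. -/
theorem tendsto_integral_mul_mul {α : Type*} [MeasurableSpace α] {μ : Measure α}
    {a b : ℕ → α → ℝ} {a₀ b₀ k : α → ℝ} {C : ℝ} (ha : ∀ n, MemLp (a n) 2 μ)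
    (hb : ∀ n, MemLp (b n) 2 μ) (ha₀ : MemLp a₀ 2 μ) (hb₀ : MemLp b₀ 2 μ)
    (hk : AEStronglyMeasurable k μ) (hkC : ∀ x, ‖k x‖ ≤ C)
    (hat : Tendsto (fun n => eLpNorm (fun x => a n x - a₀ x) 2 μ) atTop (𝓝 0))
    (hbt : Tendsto (fun n => eLpNorm (fun x => b n x - b₀ x) 2 μ) atTop (𝓝 0)) :
    Tendsto (fun n => ∫ x, k x * (a n x * b n x) ∂μ) atTop (𝓝 (∫ x, k x * (a₀ x * b₀ x) ∂μ)) := by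
  have hmul : ∀ {f : α → ℝ}, MemLp f 2 μ → MemLp (fun x => k x * f x) 2 μ := fun {f} hf =>
    hf.of_le_mul (c := C) (hk.mul hf.1) (ae_of_all _ fun x => by
      rw [norm_mul]; gcongr; exact hkC x)
  have hkt : Tendsto (fun n => eLpNorm ((fun x => k x * a n x) - fun x => k x * a₀ x) 2 μ)
      atTop (𝓝 0) := by
    have h1 : Tendsto (fun n => ENNReal.ofReal C * eLpNorm (fun x => a n x - a₀ x) 2 μ) atTop
        (𝓝 0) := by
      simpa using ENNReal.Tendsto.const_mul hat (.inr ENNReal.ofReal_ne_top)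
    refine tendsto_of_tendsto_of_tendsto_of_le_of_le tendsto_const_nhds h1 (fun _ => zero_le)
      fun n => ?_
    refine eLpNorm_le_mul_eLpNorm_of_ae_le_mul (ae_of_all _ fun x => ?_) 2
    rw [Pi.sub_apply, ← mul_sub, norm_mul]
    gcongr
    exact hkC x
  have hA := (Lp.tendsto_Lp_iff_tendsto_eLpNorm'' _ (fun n => hmul (ha n)) _ (hmul ha₀)).2 hkt
  have hB := (Lp.tendsto_Lp_iff_tendsto_eLpNorm'' _ hb _ hb₀).2 hbt
  have hin : ∀ {f g : α → ℝ} (hf : MemLp f 2 μ) (hg : MemLp g 2 μ),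
      inner ℝ (hg.toLp g) ((hmul hf).toLp _) = ∫ x, k x * (f x * g x) ∂μ := fun {f g} hf hg => by
    rw [L2.inner_def]
    refine integral_congr_ae ?_
    filter_upwards [hg.coeFn_toLp, (hmul hf).coeFn_toLp] with x h1 h2
    rw [h1, h2]
    simp [mul_assoc]
  have := hB.inner hA (𝕜 := ℝ)
  rw [hin ha₀ hb₀] at this
  exact this.congr fun n => hin (ha n) (hb n)

theorem integrable_mul_mul {α : Type*} [MeasurableSpace α] {μ : Measure α} {a b k : α → ℝ}
    {C : ℝ} (ha : MemLp a 2 μ) (hb : MemLp b 2 μ) (hk : AEStronglyMeasurable k μ)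
    (hkC : ∀ x, ‖k x‖ ≤ C) : Integrable (fun x => k x * (a x * b x)) μ :=
  (ha.integrable_mul hb).bdd_mul hk (ae_of_all _ hkC)

theorem Continuous.memLp_restrict_of_isBounded {E : Type*} [PseudoMetricSpace E] [ProperSpace E]
    [MeasurableSpace E] [OpensMeasurableSpace E] {μ : Measure E} [IsFiniteMeasureOnCompacts μ]
    {f : E → ℝ} (hf : Continuous f) {s : Set E} (hs : Bornology.IsBounded s) (p : ℝ≥0∞) :
    MemLp f p (μ.restrict s) := by
  have hc := hs.isCompact_closure
  obtain ⟨C, hC⟩ := hc.exists_bound_of_continuousOn hf.continuousOn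
  have : IsFiniteMeasure (μ.restrict (closure s)) := ⟨by simpa using hc.measure_lt_top⟩
  refine MemLp.mono_measure (Measure.restrict_mono subset_closure le_rfl)
    (MemLp.of_bound hf.aestronglyMeasurable C ?_)
  filter_upwards [ae_restrict_mem isClosed_closure.measurableSet] with x hx using hC x hx

/-- Integration by parts for two functions with traces, localized by a cutoff to a graph chart: the
identity for smooth functions passes to the limit along the approximations that define the traces.
The boundary term is written in the parameter of the graph. -/
theorem IsGraphChart.integral_mul_trace {Ω : Set Plane} (hΩ : IsOpen Ω)
    (hbdd : Bornology.IsBounded Ω) {p : Plane} {e : Plane ≃ₗᵢ[ℝ] Plane} {γ : ℝ → ℝ} {K : ℝ≥0}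
    {ρ : ℝ} (h : IsGraphChart Ω p e γ K ρ) {χ : Plane → ℝ} (hχ : ContDiff ℝ ∞ χ)
    (hχs : tsupport χ ⊆ Metric.ball p ρ) {v u : L2 Ω} {g k : Lp ℝ 2 (boundaryMeasure Ω)}
    (hv : IsTrace Ω v g) (hu : IsTrace Ω u k) {V U : Fin 2 → L2 Ω}
    (hV : IsWeakGradient Ω v V) (hU : IsWeakGradient Ω u U) (i : Fin 2) :
    IntegrableOn (fun s => (χ (graphMap p e γ s) * graphNormal e γ s i) *
      (g (graphMap p e γ s) * k (graphMap p e γ s))) (graphMap p e γ ⁻¹' Metric.ball p ρ) ∧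
    (∫ x in Ω, partialDeriv i χ x * (v x * u x)) + (∫ x in Ω, χ x * (V i x * u x)) +
        ∫ x in Ω, χ x * (v x * U i x) =
      ∫ s in graphMap p e γ ⁻¹' Metric.ball p ρ,
        (χ (graphMap p e γ s) * graphNormal e γ s i) *
          (g (graphMap p e γ s) * k (graphMap p e γ s)) := by
  obtain ⟨V', φ, hV', hφ, hφ₀, hφ₁, hφ₂⟩ := hv
  obtain ⟨U', ψ, hU', hψ, hψ₀, hψ₁, hψ₂⟩ := hu
  obtain rfl := hV'.unique hΩ hbdd hV
  obtain rfl := hU'.unique hΩ hbdd hU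
  set Γ := graphMap p e γ with hΓ
  set J : Set ℝ := Γ ⁻¹' Metric.ball p ρ with hJ
  have hΓc : Continuous Γ := h.continuous_graphMap
  have hJo : IsOpen J := Metric.isOpen_ball.preimage hΓc
  have hJb : Bornology.IsBounded J := by
    refine (Metric.isBounded_ball (x := (0 : ℝ)) (r := ρ)).subset fun s hs => ?_
    have h1 := abs_coord_le (e (Γ s - p)) 0
    rw [LinearIsometryEquiv.norm_map, hΓ, graphMap, frameMap_coord_zero] at h1
    rw [mem_ball_zero_iff]
    exact h1.trans_lt (mem_ball_iff_norm.1 hs)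
  have hmap : (volume.restrict J).map Γ ≤ boundaryMeasure Ω :=
    h.map_graphMap_le fun s hs => h.graphMap_mem_frontier hΩ hs
  have hpc : ∀ {f : Plane → ℝ}, ContDiff ℝ ∞ f → Continuous (partialDeriv i f) := fun {f} hf =>
    (hf.continuous_fderiv (by simp)).clm_apply continuous_const
  have hχc : HasCompactSupport χ :=
    Metric.isCompact_of_isClosed_isBounded (isClosed_tsupport χ) (Metric.isBounded_ball.subset hχs)
  obtain ⟨A, hA⟩ := hχ.continuous.bounded_above_of_compact_support hχc
  obtain ⟨B, hB⟩ := (hpc hχ).bounded_above_of_compact_support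
    (hχc.fderiv_apply (𝕜 := ℝ) (EuclideanSpace.single i 1))
  have hnm : Measurable fun s => graphNormal e γ s i := by
    have := measurable_deriv γ
    unfold graphNormal
    fun_prop
  have hnb : ∀ s, ‖graphNormal e γ s i‖ ≤ K + 1 := fun s => by
    refine (PiLp.norm_apply_le _ i).trans ?_
    rw [graphNormal, LinearIsometryEquiv.norm_map]
    refine (norm_vec_le _ _).trans ?_
    have : |deriv γ s| ≤ K := norm_deriv_le_of_lipschitz h.lip
    simpa using this
  have hkm : AEStronglyMeasurable (fun s => χ (Γ s) * graphNormal e γ s i) (volume.restrict J) :=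
    ((hχ.continuous.comp hΓc).measurable.mul hnm).aestronglyMeasurable
  have hkb : ∀ s, ‖χ (Γ s) * graphNormal e γ s i‖ ≤ A * (K + 1) := fun s => by
    rw [norm_mul]
    exact mul_le_mul (hA _) (hnb s) (norm_nonneg _) ((norm_nonneg _).trans (hA (Γ s)))
  -- The identity for the smooth approximations.
  have hsm : ∀ n, (∫ x in Ω, partialDeriv i χ x * (φ n x * ψ n x)) +
      (∫ x in Ω, χ x * (partialDeriv i (φ n) x * ψ n x)) +
        ∫ x in Ω, χ x * (φ n x * partialDeriv i (ψ n) x) =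
      ∫ s in J, (χ (Γ s) * graphNormal e γ s i) * (φ n (Γ s) * ψ n (Γ s)) := by
    intro n
    have hi : ∀ {f : Plane → ℝ}, Continuous f → Integrable f (volume.restrict Ω) := fun hf =>
      memLp_one_iff_integrable.1 (hf.memLp_restrict_of_isBounded hbdd 1)
    have c1 := hχ.continuous
    have c2 := (hφ n).continuous
    have c3 := (hψ n).continuous
    have d1 := hpc hχ
    have d2 := hpc (hφ n)
    have d3 := hpc (hψ n)
    have hf : ContDiff ℝ ∞ fun x => χ x * (φ n x * ψ n x) := hχ.mul ((hφ n).mul (hψ n))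
    have key := h.setIntegral_partialDeriv (hf.of_le (by simp)) hΩ
      ((tsupport_mul_subset_left (f := χ)).trans hχs) i
    have hder : ∀ x, partialDeriv i (fun x => χ x * (φ n x * ψ n x)) x =
        partialDeriv i χ x * (φ n x * ψ n x) + χ x * (partialDeriv i (φ n) x * ψ n x) +
          χ x * (φ n x * partialDeriv i (ψ n) x) := fun x => by
      have e1 := (hχ.differentiable (by simp) x).hasFDerivAt
      have e2 := ((hφ n).differentiable (by simp) x).hasFDerivAt
      have e3 := ((hψ n).differentiable (by simp) x).hasFDerivAt
      have e4 : HasFDerivAt (fun x => χ x * (φ n x * ψ n x)) _ x := e1.mul (e2.mul e3)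
      simp only [partialDeriv, e4.fderiv]
      simp
      ring
    rw [← integral_add (hi (by fun_prop)) (hi (by fun_prop)),
      ← integral_add (hi (by fun_prop)) (hi (by fun_prop))]
    simp_rw [← hder]
    rw [key, ← setIntegral_eq_integral_of_forall_compl_eq_zero (s := J) fun s hs => by
      rw [image_eq_zero_of_notMem_tsupport fun hs' => hs (hχs hs'), zero_mul, zero_mul]]
    refine integral_congr_ae (ae_of_all _ fun s => ?_)
    simp only
    ring
  have mΩ : ∀ {f : Plane → ℝ}, Continuous f → MemLp f 2 (volume.restrict Ω) := fun hf =>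
    hf.memLp_restrict_of_isBounded hbdd 2
  have mJ : ∀ {f : Plane → ℝ}, Continuous f → MemLp (fun s => f (Γ s)) 2 (volume.restrict J) :=
    fun hf => (hf.comp hΓc).memLp_restrict_of_isBounded hJb 2
  have mJL : ∀ f : Lp ℝ 2 (boundaryMeasure Ω), MemLp (fun s => f (Γ s)) 2 (volume.restrict J) :=
    fun f => ((Lp.memLp f).mono_measure hmap).comp_of_map hΓc.aemeasurable
  have tJ : ∀ {f : ℕ → Plane → ℝ} {f₀ : Lp ℝ 2 (boundaryMeasure Ω)}, (∀ n, Continuous (f n)) →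
      Tendsto (fun n => eLpNorm (fun x => f n x - f₀ x) 2 (boundaryMeasure Ω)) atTop (𝓝 0) →
      Tendsto (fun n => eLpNorm (fun s => f n (Γ s) - f₀ (Γ s)) 2 (volume.restrict J)) atTop
        (𝓝 0) := fun {f f₀} hf ht => by
    refine tendsto_of_tendsto_of_tendsto_of_le_of_le tendsto_const_nhds ht (fun _ => zero_le)
      fun n => ?_
    have hm : AEStronglyMeasurable (fun x => f n x - f₀ x) ((volume.restrict J).map Γ) :=
      ((hf n).measurable.sub (Lp.stronglyMeasurable f₀).measurable).aestronglyMeasurable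
    have := eLpNorm_map_measure (p := 2) hm hΓc.aemeasurable
    refine (le_of_eq ?_).trans (eLpNorm_mono_measure _ hmap)
    rw [this]
    rfl
  have hχm : AEStronglyMeasurable χ (volume.restrict Ω) := hχ.continuous.aestronglyMeasurable
  have lhs := ((tendsto_integral_mul_mul (fun n => mΩ (hφ n).continuous)
    (fun n => mΩ (hψ n).continuous) (Lp.memLp v) (Lp.memLp u)
    (hpc hχ).aestronglyMeasurable hB hφ₀ hψ₀).add
    (tendsto_integral_mul_mul (fun n => mΩ (hpc (hφ n))) (fun n => mΩ (hψ n).continuous)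
      (Lp.memLp (V' i)) (Lp.memLp u) hχm hA (hφ₁ i) hψ₀)).add
    (tendsto_integral_mul_mul (fun n => mΩ (hφ n).continuous) (fun n => mΩ (hpc (hψ n)))
      (Lp.memLp v) (Lp.memLp (U' i)) hχm hA hφ₀ (hψ₁ i))
  have rhs := tendsto_integral_mul_mul (fun n => mJ (hφ n).continuous)
    (fun n => mJ (hψ n).continuous) (mJL g) (mJL k) hkm hkb
    (tJ (fun n => (hφ n).continuous) hφ₂) (tJ (fun n => (hψ n).continuous) hψ₂)
  simp_rw [hsm] at lhs
  exact ⟨integrable_mul_mul (mJL g) (mJL k) hkm hkb, tendsto_nhds_unique lhs rhs⟩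

open scoped Manifold in
/-- A smooth partition of unity on a compact set, subordinate to balls centred on it. -/
theorem exists_smooth_partition {S : Set Plane} (hS : IsCompact S) {r : Plane → ℝ}
    (hr : ∀ x ∈ S, 0 < r x) :
    ∃ (t : Finset Plane) (χ : t → Plane → ℝ), (∀ i : t, (i : Plane) ∈ S) ∧
      (∀ i, ContDiff ℝ ∞ (χ i)) ∧ (∀ i, tsupport (χ i) ⊆ Metric.ball (i : Plane) (r i)) ∧
      ∀ x ∈ S, ∑ i, χ i x = 1 := by
  obtain ⟨t, htS, hcov⟩ := hS.elim_nhds_subcover (fun x => Metric.ball x (r x))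
    fun x hx => Metric.ball_mem_nhds x (hr x hx)
  obtain ⟨f, hf⟩ := SmoothPartitionOfUnity.exists_isSubordinate 𝓘(ℝ, Plane) hS.isClosed
    (fun i : t => Metric.ball (i : Plane) (r i)) (fun i => Metric.isOpen_ball) (by
      simpa [iUnion_subtype] using hcov)
  refine ⟨t, fun i => f i, fun i => htS i i.2, fun i => (f i).contMDiff.contDiff, hf,
    fun x hx => ?_⟩
  rw [← finsum_eq_sum_of_fintype]
  exact f.sum_eq_one hx

/-- Green's formula: the boundary terms cancel almost everywhere, because either the trace of the
function or its normal derivative is zero there. -/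
theorem inner_laplacian_eq {Ω Γ₀ Γ₁ : Set Plane} (hΩ : IsOpen Ω)
    (hbdd : Bornology.IsBounded Ω) (hlip : HasLipschitzBoundary Ω)
    (hnull : μH[1] (frontier Ω \ (Γ₀ ∪ Γ₁)) = 0) {w f : L2 Ω} (hw : w ∈ heatDomain Ω Γ₀ Γ₁)
    (hf : IsLaplacian Ω w f) {G : Fin 2 → L2 Ω} (hG : IsWeakGradient Ω w G) :
    inner ℝ w f = -∑ i, ‖G i‖ ^ 2 := by
  obtain ⟨-, ⟨-, g, hgt, hg0⟩, G₁, k, hG₁, hk, hk0⟩ := hw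
  obtain ⟨G₂, H, hG₂, hH, rfl⟩ := hf
  obtain rfl := hG₁.unique hΩ hbdd hG
  obtain rfl := hG₂.unique hΩ hbdd hG
  -- The weak gradients of the components of the gradient contain the terms of the Laplacian.
  have hkU : ∀ i, ∃ U, IsWeakGradient Ω (G₂ i) U ∧ U i = H i := fun i => by
    obtain ⟨U, -, hU, -⟩ := hk i
    exact ⟨U, hU, (hU i).unique hΩ hbdd (hH i)⟩
  choose U hU hUH using hkU
  have hbd : ∀ᵐ x ∂(boundaryMeasure Ω), x ∈ Γ₀ ∪ Γ₁ := by
    rw [ae_restrict_iff' isClosed_frontier.measurableSet, ae_iff]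
    refine measure_mono_null (fun x hx => ?_) hnull
    exact Classical.not_imp.1 hx
  have hloc : ∀ {p e γ K ρ} (_ : IsGraphChart Ω p e γ K ρ) {χ : Plane → ℝ}, ContDiff ℝ ∞ χ →
      tsupport χ ⊆ Metric.ball p ρ →
      ∑ i, ((∫ x in Ω, partialDeriv i χ x * (w x * G₂ i x)) +
        (∫ x in Ω, χ x * (G₂ i x * G₂ i x)) + ∫ x in Ω, χ x * (w x * H i x)) = 0 := by
    intro p e γ K ρ h χ hχ hχs
    have hterm := fun i => h.integral_mul_trace hΩ hbdd hχ hχs hgt (hk i) hG (hU i) i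
    simp only [hUH] at hterm
    rw [Finset.sum_congr rfl fun i _ => (hterm i).2,
      ← integral_finsetSum _ fun i _ => (hterm i).1]
    have hΓc := h.continuous_graphMap
    have hmap := h.map_graphMap_le (J := graphMap p e γ ⁻¹' Metric.ball p ρ)
      fun s hs => h.graphMap_mem_frontier hΩ hs
    have hae : ∀ᵐ x ∂((volume.restrict (graphMap p e γ ⁻¹' Metric.ball p ρ)).map
        (graphMap p e γ)), x ∈ Γ₀ ∪ Γ₁ ∧ (x ∈ Γ₀ → g x = 0) ∧
          (x ∈ Γ₁ → ∀ ν, IsOutwardNormal Ω x ν → ∑ i, k i x * ν i = 0) :=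
      (Measure.absolutelyContinuous_of_le hmap).ae_le (hbd.and (hg0.and hk0))
    refine integral_eq_zero_of_ae ?_
    filter_upwards [ae_of_ae_map hΓc.aemeasurable hae,
      ae_restrict_mem (Metric.isOpen_ball.preimage hΓc).measurableSet,
      ae_restrict_of_ae h.lip.ae_differentiableAt_real] with s hs hsJ hsd
    obtain ⟨hs1, hs2, hs3⟩ := hs
    simp only [Pi.zero_apply]
    rcases hs1 with hs1 | hs1
    · simp [hs2 hs1]
    · obtain ⟨hn1, hn⟩ := h.isOutwardNormal hsJ hsd
      have h0 := hs3 hs1 _ hn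
      have h1 : ∑ i, k i (graphMap p e γ s) * graphNormal e γ s i = 0 := by
        simp only [PiLp.smul_apply, smul_eq_mul, mul_left_comm (k _ _)] at h0
        rw [← Finset.mul_sum, mul_eq_zero] at h0
        exact h0.resolve_left (inv_ne_zero (one_pos.trans_le hn1).ne')
      calc _ = χ (graphMap p e γ s) * g (graphMap p e γ s) *
            ∑ i, k i (graphMap p e γ s) * graphNormal e γ s i := by
            rw [Finset.mul_sum]; exact Finset.sum_congr rfl fun i _ => by ring
        _ = 0 := by rw [h1, mul_zero]
  have hcharts : ∀ x ∈ closure Ω, ∃ ρ, ∃ e γ K, IsGraphChart Ω x e γ K ρ := fun x hx => by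
    obtain ⟨e, γ, K, ρ, h⟩ := exists_isGraphChart hΩ hlip hx
    exact ⟨ρ, e, γ, K, h⟩
  choose! r hr using hcharts
  obtain ⟨t, χ, htS, hχ, hχs, hχ1⟩ := exists_smooth_partition hbdd.isCompact_closure
    (r := r) fun x hx => by obtain ⟨_, _, _, h⟩ := hr x hx; exact h.pos
  have hsum : ∑ j, ∑ i, ((∫ x in Ω, partialDeriv i (χ j) x * (w x * G₂ i x)) +
      (∫ x in Ω, χ j x * (G₂ i x * G₂ i x)) + ∫ x in Ω, χ j x * (w x * H i x)) = 0 :=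
    Finset.sum_eq_zero fun j _ => by
      obtain ⟨_, _, _, h⟩ := hr j (htS j)
      exact hloc h (hχ j) (hχs j)
  have hχb : ∀ j, ∃ C, ∀ x, ‖χ j x‖ ≤ C := fun j =>
    (hχ j).continuous.bounded_above_of_compact_support
      (Metric.isCompact_of_isClosed_isBounded (isClosed_tsupport _)
        (Metric.isBounded_ball.subset (hχs j)))
  have hdχb : ∀ i j, ∃ C, ∀ x, ‖partialDeriv i (χ j) x‖ ≤ C := fun i j =>
    ((hχ j).continuous_fderiv (by simp)).clm_apply continuous_const
      |>.bounded_above_of_compact_support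
      (HasCompactSupport.fderiv_apply (𝕜 := ℝ) (Metric.isCompact_of_isClosed_isBounded
        (isClosed_tsupport _) (Metric.isBounded_ball.subset (hχs j))) _)
  choose C hC using hχb
  choose D hD using hdχb
  have hχi : ∀ (a b : L2 Ω) j, Integrable (fun x => χ j x * (a x * b x)) (volume.restrict Ω) :=
    fun a b j => integrable_mul_mul (Lp.memLp a) (Lp.memLp b)
      (hχ j).continuous.aestronglyMeasurable (hC j)
  have hdχi : ∀ (a b : L2 Ω) i j, Integrable (fun x => partialDeriv i (χ j) x * (a x * b x))
      (volume.restrict Ω) := fun a b i j => integrable_mul_mul (Lp.memLp a) (Lp.memLp b)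
      (((hχ j).continuous_fderiv (by simp)).clm_apply
        continuous_const).aestronglyMeasurable (hD i j)
  have s1 : ∀ a b : L2 Ω, ∑ j, ∫ x in Ω, χ j x * (a x * b x) = inner ℝ a b := fun a b => by
    rw [← integral_finsetSum _ fun j _ => hχi a b j, L2.inner_def]
    refine setIntegral_congr_fun hΩ.measurableSet fun x hx => ?_
    rw [← Finset.sum_mul, hχ1 x (subset_closure hx), one_mul, mul_comm]
    rfl
  -- The cutoffs add up to one on the open set `Ω`, so their derivatives add up to zero there.
  have s2 : ∀ (a b : L2 Ω) i, ∑ j, ∫ x in Ω, partialDeriv i (χ j) x * (a x * b x) = 0 :=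
    fun a b i => by
      rw [← integral_finsetSum _ fun j _ => hdχi a b i j]
      refine setIntegral_eq_zero_of_forall_eq_zero fun x hx => ?_
      have hd : fderiv ℝ (fun y => ∑ j, χ j y) x = ∑ j, fderiv ℝ (χ j) x :=
        fderiv_fun_sum fun j _ => (hχ j).differentiable (by simp) x
      have hc : (fun y => ∑ j, χ j y) =ᶠ[𝓝 x] fun _ => 1 := by
        filter_upwards [hΩ.mem_nhds hx] with y hy using hχ1 y (subset_closure hy)
      rw [hc.fderiv_eq, fderiv_const_apply] at hd
      have h0 : ∑ j, partialDeriv i (χ j) x = 0 := by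
        simp only [partialDeriv]
        rw [← sum_apply, ← hd]
        rfl
      rw [← Finset.sum_mul, h0, zero_mul]
  rw [Finset.sum_comm] at hsum
  simp only [Finset.sum_add_distrib, s1, s2, real_inner_self_eq_norm_sq, zero_add] at hsum
  rw [inner_sum]
  linarith

/-! ### The energy estimate -/

/-- The energy identity for a primitive with values in a Hilbert space. -/
theorem norm_sq_eq_add_integral_inner {E : Type*} [NormedAddCommGroup E] [InnerProductSpace ℝ E]
    [CompleteSpace E] {w w' : ℝ → E} {w₀ : E} {τ : ℝ} (hτ : 0 ≤ τ)
    (hw' : IntervalIntegrable w' volume 0 τ)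
    (hw : ∀ t ∈ Icc (0 : ℝ) τ, w t = w₀ + ∫ s in (0 : ℝ)..t, w' s) :
    IntervalIntegrable (fun t => 2 * inner ℝ (w t) (w' t)) volume 0 τ ∧
      ‖w τ‖ ^ 2 = ‖w₀‖ ^ 2 + ∫ t in (0 : ℝ)..τ, 2 * inner ℝ (w t) (w' t) := by
  have hsub : ∀ {x y}, x ∈ Icc (0 : ℝ) τ → y ∈ Icc (0 : ℝ) τ →
      IntervalIntegrable w' volume x y := fun {x y} hx hy => by
    refine hw'.mono_set ?_
    rw [uIcc_of_le hτ]
    exact uIcc_subset_Icc hx hy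
  have h0 : (0 : ℝ) ∈ Icc (0 : ℝ) τ := left_mem_Icc.2 hτ
  set W : ℝ → E := fun t => w₀ + ∫ s in (0 : ℝ)..t, w' s with hW
  set N : ℝ → ℝ := fun t => ∫ s in (0 : ℝ)..t, ‖w' s‖ with hN
  have hNac : AbsolutelyContinuousOnInterval N 0 τ :=
    hw'.norm.absolutelyContinuousOnInterval_intervalIntegral left_mem_uIcc
  have hdist : ∀ x ∈ Icc (0 : ℝ) τ, ∀ y ∈ Icc (0 : ℝ) τ, dist (W x) (W y) ≤ dist (N x) (N y) := by
    intro x hx y hy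
    rw [dist_eq_norm, Real.dist_eq, hW, hN]
    simp only
    rw [add_sub_add_left_eq_sub, intervalIntegral.integral_interval_sub_left (hsub h0 hx)
      (hsub h0 hy), intervalIntegral.integral_interval_sub_left (hsub h0 hx).norm
      (hsub h0 hy).norm]
    exact intervalIntegral.norm_integral_le_abs_integral_norm
  obtain ⟨M, hM⟩ : ∃ M, ∀ x ∈ Icc (0 : ℝ) τ, ‖W x‖ ≤ M := by
    have hc : ContinuousOn W (Icc 0 τ) := by
      have := intervalIntegral.continuousOn_primitive_interval' hw' left_mem_uIcc
      rw [uIcc_of_le hτ] at this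
      exact continuousOn_const.add this
    exact isCompact_Icc.exists_bound_of_continuousOn hc
  -- The increments of `‖W‖ ^ 2` are dominated by those of the primitive of `‖w'‖`.
  have hac : AbsolutelyContinuousOnInterval (fun t => ‖W t‖ ^ 2) 0 τ := by
    have h1 := hNac.const_mul (2 * M)
    refine squeeze_zero' (Eventually.of_forall fun E => Finset.sum_nonneg fun _ _ => dist_nonneg)
      ?_ (by simpa using Tendsto.const_mul (2 * M) hNac)
    filter_upwards [mem_inf_of_right (mem_principal_self _)] with E hE
    rw [Finset.mul_sum]
    refine Finset.sum_le_sum fun i hi => ?_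
    obtain ⟨hx, hy⟩ := hE.1 i hi
    rw [uIcc_of_le hτ] at hx hy
    have hd := hdist _ hx _ hy
    have hn := abs_norm_sub_norm_le (W (E.2 i).1) (W (E.2 i).2)
    rw [← dist_eq_norm] at hn
    rw [Real.dist_eq, sq_sub_sq, abs_mul, abs_of_nonneg (by positivity)]
    have := hM _ hx
    have := hM _ hy
    exact mul_le_mul (by linarith) (hn.trans hd) (abs_nonneg _)
      (by linarith [norm_nonneg (W (E.2 i).1)])
  have hWw : ∀ t ∈ Icc (0 : ℝ) τ, W t = w t := fun t ht => (hw t ht).symm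
  have hder : ∀ᵐ t, t ∈ uIoc 0 τ → deriv (fun t => ‖W t‖ ^ 2) t = 2 * inner ℝ (w t) (w' t) := by
    filter_upwards [hw'.ae_hasDerivAt_integral] with t ht htm
    have htm' := uIoc_subset_uIcc htm
    have hd := ((ht htm' 0 left_mem_uIcc).const_add w₀).norm_sq.deriv
    rw [uIcc_of_le hτ] at htm'
    rw [← hWw t htm']
    exact hd
  constructor
  · refine hac.intervalIntegrable_deriv.congr_ae ?_
    rwa [EventuallyEq, ae_restrict_iff' measurableSet_uIoc]
  · have := hac.integral_deriv_eq_sub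
    rw [intervalIntegral.integral_congr_ae hder, hWw τ (right_mem_Icc.2 hτ)] at this
    simp only [hW, intervalIntegral.integral_same, add_zero] at this
    linarith

/-- At almost every time the nonlinearity dissipates, Green's formula and the Poincaré constant
produce `-c ‖w‖²`, and the source is absorbed by it. -/
theorem inner_deriv_le {Ω Γ₀ Γ₁ : Set Plane} (hΩ : IsOpen Ω)
    (hbdd : Bornology.IsBounded Ω) (hlip : HasLipschitzBoundary Ω)
    (hnull : μH[1] (frontier Ω \ (Γ₀ ∪ Γ₁)) = 0) {c : ℝ} (hc : IsPoincareConstant Ω Γ₀ c)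
    {F : ℝ → ℝ} (hF : ∀ ζ, ζ * F ζ ≤ 0) {w w' f r : L2 Ω} {a : ℝ}
    (hw : w ∈ heatDomain Ω Γ₀ Γ₁) (hf : IsLaplacian Ω w f)
    (heq : ∀ᵐ ξ ∂(volume.restrict Ω), w' ξ = f ξ + F (w ξ) + r ξ * a) :
    2 * inner ℝ w w' ≤ (2 * c)⁻¹ * ‖r‖ ^ 2 * a ^ 2 := by
  have hle : inner ℝ w (w' - f - a • r) ≤ 0 := by
    rw [L2.inner_def]
    refine integral_nonpos_of_ae ?_
    filter_upwards [heq, Lp.coeFn_sub (w' - f) (a • r), Lp.coeFn_sub w' f,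
      Lp.coeFn_smul a r] with ξ h1 h2 h3 h4
    rw [h2, Pi.sub_apply, h3, Pi.sub_apply, h4, Pi.smul_apply, h1, smul_eq_mul]
    have : inner ℝ (w ξ) (f ξ + F (w ξ) + r ξ * a - f ξ - a * r ξ) = w ξ * F (w ξ) := by
      simp only [RCLike.inner_apply, conj_trivial]
      ring
    rw [this]
    exact hF _
  rw [inner_sub_right, inner_sub_right, inner_smul_right] at hle
  obtain ⟨hc0, hP⟩ := hc
  obtain ⟨G, -, hG, -⟩ := id hf
  have h1 := inner_laplacian_eq hΩ hbdd hlip hnull hw hf hG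
  have h2 := hP w hw.2.1 G hG
  have h3 : a * inner ℝ w r ≤ |a| * (‖w‖ * ‖r‖) :=
    (le_abs_self _).trans (by rw [abs_mul]; gcongr; exact abs_real_inner_le_norm w r)
  have h4 : 2 * (|a| * (‖w‖ * ‖r‖)) ≤ 2 * c * ‖w‖ ^ 2 + (2 * c)⁻¹ * ‖r‖ ^ 2 * a ^ 2 := by
    have h5 : 0 ≤ (2 * c)⁻¹ * (2 * c * ‖w‖ - |a| * ‖r‖) ^ 2 := by positivity
    have h6 : (2 * c)⁻¹ * (2 * c * ‖w‖ - |a| * ‖r‖) ^ 2 =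
        2 * c * ‖w‖ ^ 2 - 2 * (|a| * (‖w‖ * ‖r‖)) + (2 * c)⁻¹ * ‖r‖ ^ 2 * |a| ^ 2 := by
      field_simp
      ring
    rw [h6, sq_abs] at h5
    linarith
  linarith

theorem mainTheorem11 (Ω Γ₀ Γ₁ : Set Plane)
    (hΩ_open : IsOpen Ω) (hΩ_conn : IsConnected Ω) (hΩ_bdd : Bornology.IsBounded Ω)
    (hΩ_lip : HasLipschitzBoundary Ω)
    (hΓ_cover : frontier Ω = closure (Γ₀ ∪ Γ₁)) (hΓ_disj : Disjoint Γ₀ Γ₁)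
    (hΓ_null : μH[1] (frontier Ω \ (Γ₀ ∪ Γ₁)) = 0) (hΓ₀ : 0 < μH[1] Γ₀) :
    (∃ c, IsPoincareConstant Ω Γ₀ c) ∧
    ∀ c, IsPoincareConstant Ω Γ₀ c →
      ∀ F : ℝ → ℝ, (∀ ζ, ζ * F ζ ≤ 0) →
        ∀ τ : ℝ, 0 < τ →
          ∀ (u : Lp ℝ 2 (volume.restrict (Icc (0 : ℝ) τ))) (r w₀ : L2 Ω) (w : ℝ → L2 Ω),
            IsStrictSolution Ω Γ₀ Γ₁ F τ u r w₀ w →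
              ‖w τ‖ ^ 2 ≤ ‖w₀‖ ^ 2 + 4 / c * ‖u‖ ^ 2 * ‖r‖ ^ 2 := by
  refine ⟨exists_isPoincareConstant hΩ_open hΩ_conn hΩ_bdd hΩ_lip
    (subset_union_left.trans (subset_closure.trans hΓ_cover.ge)) hΓ₀, ?_⟩
  rintro c hc F hF τ hτ u r w₀ w ⟨w', Aw, hw', hw, -, hae⟩
  have hc0 := hc.1
  have hw'i : IntervalIntegrable w' volume 0 τ := by
    rw [intervalIntegrable_iff_integrableOn_Icc_of_le hτ.le]
    exact hw'.integrable one_le_two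
  obtain ⟨hint, hsq⟩ := norm_sq_eq_add_integral_inner hτ.le hw'i hw
  have hu2 : Integrable (fun t => u t ^ 2) (volume.restrict (Icc 0 τ)) :=
    (Lp.memLp u).integrable_sq
  have hun : ∫ t in Icc 0 τ, u t ^ 2 = ‖u‖ ^ 2 := by
    rw [← real_inner_self_eq_norm_sq, L2.inner_def]
    refine integral_congr_ae (ae_of_all _ fun t => ?_)
    simp [sq]
  have hle : ∫ t in (0 : ℝ)..τ, 2 * inner ℝ (w t) (w' t) ≤
      (2 * c)⁻¹ * ‖r‖ ^ 2 * ‖u‖ ^ 2 := by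
    rw [intervalIntegrable_iff_integrableOn_Icc_of_le hτ.le] at hint
    rw [intervalIntegral.integral_of_le hτ.le, ← integral_Icc_eq_integral_Ioc, ← hun,
      ← integral_const_mul]
    refine integral_mono_ae hint (hu2.const_mul _) ?_
    filter_upwards [hae] with t ht
    exact inner_deriv_le hΩ_open hΩ_bdd hΩ_lip hΓ_null hc hF ht.1 ht.2.1 ht.2.2
  have hcc : (2 * c)⁻¹ ≤ 4 / c := by
    rw [inv_eq_one_div, div_le_div_iff₀ (by positivity) hc0]
    linarith
  have : (2 * c)⁻¹ * ‖r‖ ^ 2 * ‖u‖ ^ 2 ≤ 4 / c * ‖u‖ ^ 2 * ‖r‖ ^ 2 := by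
    rw [mul_assoc, mul_assoc, mul_comm (‖u‖ ^ 2)]
    gcongr
  linarith
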